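/- Let $\mathbb{R}^{(\mathbb{N})}$ be the space of finitely supported real sequences indexed by $\mathbb{N}=\{1,2,\dots\}$, and regard $\mathbb{R}^n$ as the subspace of sequences vanishing beyond the $n$-th coordinate. The symmetric group $\mathrm{Sym}(n)$ acts on $\mathbb{R}^n$ by permuting coordinates. A $\mathrm{Sym}$-invariant chain of cones is an ascending chain $\mathcal{C}=(C_n)_{n\ge1}$ in which each $C_n\subseteq\mathbb{R}^n$ is a $\mathrm{Sym}(n)$-invariant convex cone containing $0$. It stabilizes if there is $r\ge1$ such that, for all $n\ge m\ge r$, the cone $C_n$ is generated by $\mathrm{Sym}(n)(C_m)=\{\sigma(u):\sigma\in\mathrm{Sym}(n),\ u\in C_m\}$; the least such $r$ is its stability index. Stabilization and the stability index of an ascending chain of monoids $M_n\subseteq\mathbb{Z}^n$, each $\mathrm{Sym}(n)$-invariant, are defined in the same way, with "generated as a monoid" in place of "generated as a cone". A cone $C$ is pointed if $C\cap(-C)=\{0\}$. For $u\in\mathbb{Z}^n$ put $\|u\|=\sum_i|u_i|$, and for a finite set $A\subseteq\mathbb{Z}^n$ put $\|A\|=\max_{u\in A}\|u\|$ (with $\|\emptyset\|=0$).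 Let $\mathcal{C}=(C_n)_{n\ge1}$ be a stabilizing $\mathrm{Sym}$-invariant chain of cones with stability index $r$, where every $C_n$ is pointed and is generated by finitely many integer vectors. Put $M_n=C_n\cap\mathbb{Z}^n$, and let $\mathcal{H}_n$ be the Hilbert basis of $M_n$, i.e. the set of those nonzero $u\in M_n$ for which $u=v+w$ with $v,w\in M_n$ implies $v=0$ or $w=0$; it is a finite set and the least generating set of the monoid $M_n$. Then the chain of monoids $(M_n)_{n\ge1}$ stabilizes, and its stability index is at most $$\max\{3r^2,\ \|\mathcal{H}_{3r^2}\|\}.$$ This bound is sharp: for every integer $a\ge 11$, the chain given by $C_1=\{0\}$ and, for $n\ge2$, $C_n$ the cone generated by $\mathrm{Sym}(n)\big(\{(-1,a,0,\dots,0)\}\big)$ satisfies all the hypotheses above, has stability index $r=2$, and its chain of monoids has stability index exactly $a+1=\max\{3r^2,\|\mathcal{H}_{3r^2}\|\}$. -/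

import Mathlib

/-!
Coordinates are indexed by `ℕ` starting from `0`: the space of finitely supported real sequences is
`ℕ →₀ ℝ`, its integer points are `ℕ →₀ ℤ`, and the subspace `K ^ n` consists of the sequences
that vanish at every index `i ≥ n`. Chains `(A_n)_{n ≥ 1}` are functions of `n : ℕ` of which only
the values at `n ≥ 1` matter.
-/

/-- `Sym(n)`, as the group of the permutations of `ℕ` that fix every index `i ≥ n`. -/
def symGroup (n : ℕ) : Subgroup (Equiv.Perm ℕ) :=
  fixingSubgroup (Equiv.Perm ℕ) {i : ℕ | n ≤ i}

/-- `Sym(n)(A) = {σ(u) | σ ∈ Sym(n), u ∈ A}`, where `σ(u)_i = u_{σ⁻¹(i)}`. -/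
def symOrbit {K : Type*} [Zero K] (n : ℕ) (A : Set (ℕ →₀ K)) : Set (ℕ →₀ K) :=
  {v | ∃ σ ∈ symGroup n, ∃ u ∈ A, v = Finsupp.equivMapDomain σ u}

/-- An ascending chain of cones `C_n ⊆ ℝ ^ n`, `n ≥ 1`, with each `C_n` invariant under `Sym(n)`.
A `PointedCone` of Mathlib is a convex cone that contains `0`. -/
structure IsSymInvariantChain (C : ℕ → PointedCone ℝ (ℕ →₀ ℝ)) : Prop where
  ascending : ∀ m n, 1 ≤ m → m ≤ n → C m ≤ C n
  vanish : ∀ n, 1 ≤ n → ∀ u ∈ C n, ∀ i, n ≤ i → u i = 0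
  invariant : ∀ n, 1 ≤ n → symOrbit n (C n : Set (ℕ →₀ ℝ)) ⊆ C n

/-- `C_n = cone(Sym(n)(C_m))` for all `n ≥ m ≥ r`. -/
def ConesStabilizeAt (C : ℕ → PointedCone ℝ (ℕ →₀ ℝ)) (r : ℕ) : Prop :=
  ∀ m n, r ≤ m → m ≤ n → C n = PointedCone.hull ℝ (symOrbit n (C m : Set (ℕ →₀ ℝ)))

/-- The chain of cones stabilizes, and its stability index is `r`. -/
def IsConeStabilityIndex (C : ℕ → PointedCone ℝ (ℕ →₀ ℝ)) (r : ℕ) : Prop :=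
  IsLeast {r : ℕ | 1 ≤ r ∧ ConesStabilizeAt C r} r

/-- `M_n = mn(Sym(n)(M_m))` for all `n ≥ m ≥ r`. -/
def MonoidsStabilizeAt (M : ℕ → AddSubmonoid (ℕ →₀ ℤ)) (r : ℕ) : Prop :=
  ∀ m n, r ≤ m → m ≤ n → M n = AddSubmonoid.closure (symOrbit n (M m : Set (ℕ →₀ ℤ)))

/-- The chain of monoids stabilizes, and its stability index is `r`. -/
def IsMonoidStabilityIndex (M : ℕ → AddSubmonoid (ℕ →₀ ℤ)) (r : ℕ) : Prop :=
  IsLeast {r : ℕ | 1 ≤ r ∧ MonoidsStabilizeAt M r} r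

/-- The inclusion of the integer sequences into the real sequences. -/
noncomputable def intToReal : (ℕ →₀ ℤ) →+ (ℕ →₀ ℝ) :=
  Finsupp.mapRange.addMonoidHom (Int.castAddHom ℝ)

/-- A cone is pointed if its lineality space `{u ∈ C | -u ∈ C}` is zero. -/
def IsPointed (C : PointedCone ℝ (ℕ →₀ ℝ)) : Prop :=
  C.lineal = ⊥

/-- A cone that is generated by finitely many integer vectors. -/
def IsFinGenRational (C : PointedCone ℝ (ℕ →₀ ℝ)) : Prop :=
  ∃ A : Set (ℕ →₀ ℤ), A.Finite ∧ C = PointedCone.hull ℝ (intToReal '' A)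

/-- The monoid of the integer points of a cone. -/
noncomputable def latticePoints (C : PointedCone ℝ (ℕ →₀ ℝ)) : AddSubmonoid (ℕ →₀ ℤ) :=
  C.toAddSubmonoid.comap intToReal

/-- The Hilbert basis of a positive affine monoid: the set of its irreducible elements. -/
def hilbertBasis (M : AddSubmonoid (ℕ →₀ ℤ)) : Set (ℕ →₀ ℤ) :=
  {u | u ∈ M ∧ u ≠ 0 ∧ ∀ v ∈ M, ∀ w ∈ M, u = v + w → v = 0 ∨ w = 0}

/-- `‖u‖ = ∑ |u_i|`. -/
def oneNorm (u : ℕ →₀ ℤ) : ℕ :=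
  u.sum fun _ a => a.natAbs

/-- `‖A‖ = sup {‖u‖ | u ∈ A}`, for a finite set `A` (it is `0` for the empty set). -/
noncomputable def setNorm (A : Set (ℕ →₀ ℤ)) : ℕ :=
  sSup (oneNorm '' A)

/-- The chain with `C_n = cone(Sym(n){(-1, a, 0, 0, …)})` for `n ≥ 2` and `C_1 = 0`. -/
noncomputable def exampleChain (a : ℕ) (n : ℕ) : PointedCone ℝ (ℕ →₀ ℝ) :=
  if n < 2 then ⊥
  else PointedCone.hull ℝ (symOrbit n {Finsupp.single 0 (-1 : ℝ) + Finsupp.single 1 (a : ℝ)})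

open Finset

/-! For `n ≥ r` the cone `C_n` is generated by the `Sym(n)`-orbit of a finite set `A` living in the
first `r` coordinates, so every generator has at most `r` nonzero entries. A generator therefore
vanishes somewhere on any `r` indices if it is nonzero at another one, and a swap can move a nonzero
entry there. Combined with Farkas' lemma, this gives two facts.

Saturation (`mem_hull_symOrbit_of_succ`): for `n ≥ 2r`, a point of `C_{n+1}` with last coordinate
zero lies in `C_n`. Merging (`merge_mem_hull`): if a point of the cone has at least `2r` positive
coordinates, adding the least of them to the second least and putting zero in its place stays in the
cone. By negation the same holds for negative coordinates.

Let `h` be a Hilbert basis element of `M_{n+1}` without zero coordinates, with `n + 1 ≥ 4r - 1`.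
Some sign occurs at least `2r` times, and merging followed by saturation gives an element of `M_n`
with the same norm and again no zero among its `n` coordinates. It is irreducible, because a
decomposition of it can be spread back to one of `h` (`exists_mem_hilbertBasis_of_succ`). Descending
to level `m = 3r²`, the norm of `h`, which is at least `n + 1`, is at most `‖H_m‖`. So beyond
`max(m, ‖H_m‖)` every Hilbert basis element has a zero coordinate, and saturation puts it in the
orbit of the preceding level.

In the example the lattice points are those whose positive part has sum at least `a` times that of
the negative part. The irreducible ones have norm at most `a + 1`, and `(-1, 1, ..., 1)` with `a`
ones is irreducible and first appears at level `a + 1`. -/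

/-! ### Finite permutations and orbits -/

theorem mem_symGroup {n : ℕ} {σ : Equiv.Perm ℕ} : σ ∈ symGroup n ↔ ∀ i, n ≤ i → σ i = i := by
  simp [symGroup, mem_fixingSubgroup_iff]

theorem symGroup_mono {m n : ℕ} (h : m ≤ n) : symGroup m ≤ symGroup n := fun _ hσ =>
  mem_symGroup.2 fun i hi => mem_symGroup.1 hσ i (h.trans hi)

theorem swap_mem_symGroup {n k l : ℕ} (hk : k < n) (hl : l < n) :
    Equiv.swap k l ∈ symGroup n :=
  mem_symGroup.2 fun i hi => Equiv.swap_apply_of_ne_of_ne (by omega) (by omega)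

theorem apply_lt_of_mem_symGroup {n : ℕ} {σ : Equiv.Perm ℕ} (hσ : σ ∈ symGroup n) {i : ℕ}
    (hi : i < n) : σ i < n := by
  by_contra h
  have h1 := mem_symGroup.1 hσ (σ i) (not_lt.1 h)
  have := σ.injective h1
  omega

instance finite_symGroup (n : ℕ) : Finite (symGroup n) :=
  Finite.of_injective
    (fun σ : symGroup n => (Equiv.Perm.subtypeEquivSubtypePerm (fun a => a < n)).symm
      ⟨σ.1, fun a ha => mem_symGroup.1 σ.2 a (not_lt.1 ha)⟩)
    fun _ _ h => Subtype.ext (congrArg (fun f => f.1) ((Equiv.injective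
      (Equiv.Perm.subtypeEquivSubtypePerm (fun a => a < n)).symm) h))

theorem equivMapDomain_swap {K : Type*} [AddCommGroup K] (k l : ℕ) (x : ℕ →₀ K) :
    Finsupp.equivMapDomain (Equiv.swap k l) x =
      x + Finsupp.single k (x l - x k) - Finsupp.single l (x l - x k) := by
  ext i
  simp only [Finsupp.equivMapDomain_apply, Equiv.symm_swap, Finsupp.coe_add, Finsupp.coe_sub,
    Pi.add_apply, Pi.sub_apply, Finsupp.single_apply, Equiv.swap_apply_def]
  split_ifs <;> subst_vars <;> simp_all

theorem equivMapDomain_swap_swap {K : Type*} [Zero K] (k l : ℕ) (x : ℕ →₀ K) :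
    Finsupp.equivMapDomain (Equiv.swap k l) (Finsupp.equivMapDomain (Equiv.swap k l) x) = x := by
  ext i
  simp

theorem equivMapDomain_mul {K : Type*} [Zero K] (σ τ : Equiv.Perm ℕ) (x : ℕ →₀ K) :
    Finsupp.equivMapDomain (σ * τ) x =
      Finsupp.equivMapDomain σ (Finsupp.equivMapDomain τ x) := by
  ext i
  rfl

theorem card_support_equivMapDomain {K : Type*} [Zero K] (σ : Equiv.Perm ℕ) (x : ℕ →₀ K) :
    (Finsupp.equivMapDomain σ x).support.card = x.support.card := by
  simp [Finsupp.equivMapDomain]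

theorem equivMapDomain_mem_symOrbit {K : Type*} [Zero K] {n : ℕ} {A : Set (ℕ →₀ K)}
    {σ : Equiv.Perm ℕ} (hσ : σ ∈ symGroup n) {x : ℕ →₀ K} (hx : x ∈ symOrbit n A) :
    Finsupp.equivMapDomain σ x ∈ symOrbit n A := by
  obtain ⟨τ, hτ, u, hu, rfl⟩ := hx
  exact ⟨σ * τ, mul_mem hσ hτ, u, hu, (equivMapDomain_mul _ _ _).symm⟩

theorem subset_symOrbit {K : Type*} [Zero K] (n : ℕ) (A : Set (ℕ →₀ K)) : A ⊆ symOrbit n A :=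
  fun x hx => ⟨1, one_mem _, x, hx, by ext; rfl⟩

theorem finite_symOrbit {K : Type*} [Zero K] (n : ℕ) {A : Set (ℕ →₀ K)} (hA : A.Finite) :
    (symOrbit n A).Finite := by
  refine ((Set.finite_univ (α := symGroup n)).image2
    (fun σ u => Finsupp.equivMapDomain σ.1 u) hA).subset ?_
  rintro _ ⟨σ, hσ, u, hu, rfl⟩
  exact ⟨⟨σ, hσ⟩, trivial, u, hu, rfl⟩

/-! ### Separation by linear functionals -/

/-- **Farkas' lemma** for finitely many generators. -/
theorem exists_dual_of_notMem_hull_image {ι E : Type*} [AddCommGroup E] [Module ℝ E]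
    (s : Finset ι) : ∀ (v : ι → E) (x : E), x ∉ PointedCone.hull ℝ (v '' s) →
      ∃ f : E →ₗ[ℝ] ℝ, (∀ i ∈ s, 0 ≤ f (v i)) ∧ f x < 0 := by
  classical
  induction s using Finset.induction_on with
  | empty =>
    intro v x hx
    have hx0 : x ≠ 0 := by
      rintro rfl
      exact hx (zero_mem _)
    obtain ⟨f, hf⟩ := not_forall.1 (mt (Module.forall_dual_apply_eq_zero_iff ℝ x).1 hx0)
    rcases lt_or_gt_of_ne hf with h | h
    · exact ⟨f, by simp, h⟩
    · exact ⟨-f, by simp, by simpa using h⟩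
  | insert a s ha ih =>
    intro v x hx
    have hsub : PointedCone.hull ℝ (v '' s) ≤ PointedCone.hull ℝ (v '' (insert a s : Finset ι)) :=
      Submodule.span_mono (Set.image_mono (by simp))
    have hamem : v a ∈ PointedCone.hull ℝ (v '' (insert a s : Finset ι)) :=
      PointedCone.subset_hull ⟨a, by simp, rfl⟩
    obtain ⟨f, hf, hfx⟩ := ih v x fun h => hx (hsub h)
    by_cases hfa : 0 ≤ f (v a)
    · exact ⟨f, by simpa [hfa] using hf, hfx⟩
    push Not at hfa
    -- Everything is projected to the kernel of `f` along `v a`; the induction hypothesis applies to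
    -- the projected family.
    by_cases hx' : x - (f x / f (v a)) • v a ∈
        PointedCone.hull ℝ ((fun i => v i - (f (v i) / f (v a)) • v a) '' s)
    · refine absurd ?_ hx
      have hle : PointedCone.hull ℝ ((fun i => v i - (f (v i) / f (v a)) • v a) '' s) ≤
          PointedCone.hull ℝ (v '' (insert a s : Finset ι)) := by
        refine Submodule.span_le.2 ?_
        rintro _ ⟨i, hi, rfl⟩
        have h1 : v i - (f (v i) / f (v a)) • v a = v i + (f (v i) / -f (v a)) • v a := by
          rw [div_neg, neg_smul, sub_eq_add_neg]
        show v i - (f (v i) / f (v a)) • v a ∈ _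
        rw [h1]
        exact add_mem (hsub (PointedCone.subset_hull ⟨i, hi, rfl⟩))
          (PointedCone.smul_mem _ (div_nonneg (hf i hi) (by linarith)) hamem)
      have := add_mem (hle hx') (PointedCone.smul_mem _ (div_pos_of_neg_of_neg hfx hfa).le hamem)
      simpa using this
    · obtain ⟨g, hg, hgx⟩ := ih _ _ hx'
      refine ⟨g - (g (v a) / f (v a)) • f, ?_, ?_⟩
      · intro i hi
        rcases Finset.mem_insert.1 hi with rfl | hi
        · simp [hfa.ne]
        · have := hg i hi
          simp only [map_sub, map_smul, smul_eq_mul] at this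
          simp only [LinearMap.sub_apply, LinearMap.smul_apply, smul_eq_mul]
          convert this using 2
          ring
      · simp only [map_sub, map_smul, smul_eq_mul] at hgx
        simp only [LinearMap.sub_apply, LinearMap.smul_apply, smul_eq_mul]
        convert hgx using 2
        ring

/-- The pairing `∑ x_i y_i` of a sequence with a finitely supported one. -/
noncomputable def pairing (y : ℕ → ℝ) : (ℕ →₀ ℝ) →ₗ[ℝ] ℝ :=
  Finsupp.linearCombination ℝ y

theorem pairing_single (y : ℕ → ℝ) (k : ℕ) (c : ℝ) :
    pairing y (Finsupp.single k c) = c * y k := by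
  simp [pairing]

theorem pairing_equivMapDomain (y : ℕ → ℝ) (σ : Equiv.Perm ℕ) (x : ℕ →₀ ℝ) :
    pairing y (Finsupp.equivMapDomain σ x) = pairing (y ∘ σ) x :=
  Finsupp.linearCombination_equivMapDomain ℝ σ x

theorem pairing_swap (y : ℕ → ℝ) (k l : ℕ) (x : ℕ →₀ ℝ) :
    pairing y (Finsupp.equivMapDomain (Equiv.swap k l) x) =
      pairing y x + (x l - x k) * (y k - y l) := by
  rw [equivMapDomain_swap, map_sub, map_add, pairing_single, pairing_single]
  ring

theorem pairing_update (y : ℕ → ℝ) (k : ℕ) (c : ℝ) (x : ℕ →₀ ℝ) :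
    pairing (Function.update y k c) x = pairing y x + x k * (c - y k) := by
  rw [pairing, pairing, Finsupp.linearCombination_apply, Finsupp.linearCombination_apply,
    Finsupp.sum_of_support_subset x (s := insert k x.support) (by simp) _ (by simp),
    Finsupp.sum_of_support_subset x (s := insert k x.support) (by simp) _ (by simp),
    Finset.sum_eq_sum_sdiff_singleton_add (mem_insert_self _ _),
    Finset.sum_eq_sum_sdiff_singleton_add (mem_insert_self k x.support)]
  rw [Finset.sum_congr rfl (g := fun i => x i • y i) fun i hi => ?_]
  · simp
    ring
  · rw [Function.update_of_ne]
    simpa using (mem_sdiff.1 hi).2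

theorem pairing_eq_sum_range {n : ℕ} (y : ℕ → ℝ) {x : ℕ →₀ ℝ} (hx : ∀ i, n ≤ i → x i = 0) :
    pairing y x = ∑ i ∈ range n, x i * y i := by
  rw [pairing, Finsupp.linearCombination_apply, Finsupp.sum_of_support_subset x (s := range n)]
  · rfl
  · intro i hi
    by_contra h
    exact Finsupp.mem_support_iff.1 hi (hx i (by simpa using h))
  · simp

theorem pairing_nonneg_of_mem_hull {T : Set (ℕ →₀ ℝ)} {y : ℕ → ℝ}
    (h : ∀ x ∈ T, 0 ≤ pairing y x) {x : ℕ →₀ ℝ} (hx : x ∈ PointedCone.hull ℝ T) :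
    0 ≤ pairing y x := by
  induction hx using Submodule.span_induction with
  | mem x hx => exact h x hx
  | zero => simp
  | add x z _ _ hx hz => rw [map_add]; exact add_nonneg hx hz
  | smul c x _ hx =>
    have : pairing y (c • x) = (c : ℝ) * pairing y x := (pairing y).map_smul (c : ℝ) x
    rw [this]
    exact mul_nonneg c.2 hx

theorem exists_pairing_neg {T : Set (ℕ →₀ ℝ)} (hT : T.Finite) {x : ℕ →₀ ℝ}
    (hx : x ∉ PointedCone.hull ℝ T) :
    ∃ y : ℕ → ℝ, (∀ z ∈ T, 0 ≤ pairing y z) ∧ pairing y x < 0 := by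
  obtain ⟨f, hf, hfx⟩ := exists_dual_of_notMem_hull_image hT.toFinset id x (by simpa using hx)
  have : pairing (fun k => f (Finsupp.single k 1)) = f := by
    ext k
    simp [pairing_single]
  exact ⟨fun k => f (Finsupp.single k 1), by simpa [this] using hf, by rwa [this]⟩

/-! ### Sparse symmetric sets and averaged functionals -/

/-- Pigeonhole; it supplies the zero entry against which a nonzero entry of a generator is swapped.
-/
theorem exists_mem_apply_eq_zero {r k : ℕ} {x : ℕ →₀ ℝ} {S : Finset ℕ} (hx : x.support.card ≤ r)
    (hS : r ≤ S.card) (hk : x k ≠ 0) (hkS : k ∉ S) : ∃ l ∈ S, x l = 0 := by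
  by_contra! h
  have : insert k S ⊆ x.support := by
    intro l hl
    rcases mem_insert.1 hl with rfl | hl
    · simpa using hk
    · simpa using h l hl
  have := card_le_card this
  rw [card_insert_of_notMem hkS] at this
  omega

/-- A finite set of vectors of `ℝ ^ n`, with at most `r` nonzero coordinates each, that is invariant
under `Sym(n)`. -/
structure IsSparseSymSet (n r : ℕ) (T : Set (ℕ →₀ ℝ)) : Prop where
  finite : T.Finite
  vanish : ∀ x ∈ T, ∀ i, n ≤ i → x i = 0
  invariant : ∀ σ ∈ symGroup n, ∀ x ∈ T, Finsupp.equivMapDomain σ x ∈ T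
  card_support_le : ∀ x ∈ T, x.support.card ≤ r

theorem isSparseSymSet_symOrbit {n r : ℕ} (hrn : r ≤ n) {A : Set (ℕ →₀ ℝ)} (hA : A.Finite)
    (hAr : ∀ x ∈ A, ∀ i, r ≤ i → x i = 0) : IsSparseSymSet n r (symOrbit n A) where
  finite := finite_symOrbit n hA
  vanish := by
    rintro _ ⟨σ, hσ, u, hu, rfl⟩ i hi
    have h1 : σ.symm i = i := mem_symGroup.1 (inv_mem hσ) i hi
    rw [Finsupp.equivMapDomain_apply, h1]
    exact hAr u hu i (hrn.trans hi)
  invariant σ hσ x hx := equivMapDomain_mem_symOrbit hσ hx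
  card_support_le := by
    rintro _ ⟨σ, hσ, u, hu, rfl⟩
    rw [card_support_equivMapDomain]
    have : u.support ⊆ range r := fun i hi => by
      by_contra h
      exact Finsupp.mem_support_iff.1 hi (hAr u hu i (by simpa using h))
    simpa using card_le_card this

/-- The sum of the pairings over the powers of a cycle on `B`. -/
theorem sum_cycle_pairing {n : ℕ} {x : ℕ →₀ ℝ} (hx : ∀ i, n ≤ i → x i = 0) (y : ℕ → ℝ)
    {B : Finset ℕ} (hB : B ⊆ range n) {σ : Equiv.Perm ℕ} (hσ : σ.IsCycleOn B)
    (hσB : ∀ i ∉ B, σ i = i) :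
    ∑ k ∈ range B.card, pairing (y ∘ (σ ^ k : Equiv.Perm ℕ)) x =
      B.card * ∑ i ∈ range n \ B, x i * y i + (∑ i ∈ B, x i) * ∑ i ∈ B, y i := by
  have hfix : ∀ k : ℕ, ∀ i ∉ B, (σ ^ k : Equiv.Perm ℕ) i = i := fun k i hi =>
    Equiv.Perm.pow_apply_eq_self_of_apply_eq_self (hσB i hi) k
  rw [sum_mul_sum_eq_sum_perm hσ]
  have h1 : ∀ k ∈ range B.card, pairing (y ∘ (σ ^ k : Equiv.Perm ℕ)) x =
      ∑ i ∈ range n \ B, x i * y i + ∑ i ∈ B, x i * y ((σ ^ k : Equiv.Perm ℕ) i) := by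
    intro k _
    rw [pairing_eq_sum_range _ hx, ← sum_sdiff hB]
    congr 1
    refine sum_congr rfl fun i hi => ?_
    rw [Function.comp_apply, hfix k i (mem_sdiff.1 hi).2]
  rw [sum_congr rfl h1, sum_add_distrib]
  simp

/-- Swapping moves positive entries of `x` out of `K \ B` without increasing the new functional.
Afterwards, averaging the old inequality over cyclic shifts of `B` replaces `y` by its mean there,
and lowering `y` to `θ` on `K \ B` only helps. -/
theorem pairing_mean_nonneg {n r : ℕ} {T : Set (ℕ →₀ ℝ)} (hT : IsSparseSymSet n r T) {y : ℕ → ℝ}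
    (hy : ∀ x ∈ T, 0 ≤ pairing y x) {J B K : Finset ℕ} (hJn : J ⊆ range n) (hKn : K ⊆ range n)
    (hBK : B ⊆ K) (hJK : Disjoint J K) (hJB : r ≤ (J ∪ B).card) (hKB : r ≤ (K \ B).card)
    (hB : B.Nonempty) {θ : ℝ} (hθ : θ * B.card = ∑ i ∈ B, y i) (hJ : ∀ l ∈ J, y l ≤ θ)
    (hK : ∀ k ∈ K \ B, θ ≤ y k) :
    ∀ x ∈ T, 0 ≤ pairing (fun k => if k ∈ K then θ else y k) x := by
  set z : ℕ → ℝ := fun k => if k ∈ K then θ else y k with hz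
  have hzK : ∀ k ∈ K, z k = θ := fun k hk => by simp [hz, hk]
  have hzJ : ∀ l ∈ J, z l = y l := fun l hl => by simp [hz, disjoint_left.1 hJK hl]
  -- Induction on the number of entries of the wrong sign: negative on `B` or positive on `K \ B`.
  -- Each swap with a zero entry lowers it.
  suffices H : ∀ N : ℕ, ∀ x ∈ T,
      (B.filter (fun k => x k < 0)).card + ((K \ B).filter (fun k => 0 < x k)).card = N →
      0 ≤ pairing z x from fun x hx => H _ x hx rfl
  intro N
  induction N using Nat.strong_induction_on with
  | _ N ih =>
  intro x hx hN
  by_cases h1 : ∃ k ∈ B, x k < 0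
  · obtain ⟨k, hkB, hk⟩ := h1
    obtain ⟨l, hl, hl0⟩ := exists_mem_apply_eq_zero (hT.card_support_le x hx) hKB hk.ne
      (by simp [hkB])
    have hlK := (mem_sdiff.1 hl).1
    have hlB := (mem_sdiff.1 hl).2
    have hkl : k ≠ l := fun h => hlB (h ▸ hkB)
    have hmem := hT.invariant _ (swap_mem_symGroup (mem_range.1 (hKn (hBK hkB)))
      (mem_range.1 (hKn hlK))) x hx
    have hval := pairing_swap z k l x
    rw [hzK k (hBK hkB), hzK l hlK, sub_self, mul_zero, add_zero] at hval
    rw [← hval]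
    refine ih _ ?_ _ hmem rfl
    rw [← hN]
    refine add_lt_add_of_lt_of_le (card_lt_card ?_) (card_le_card ?_)
    · rw [Finset.ssubset_iff_of_subset]
      · exact ⟨k, by simp [hkB, hk], by rw [mem_filter]; simp [hl0]⟩
      · intro i hi
        rw [mem_filter] at hi ⊢
        refine ⟨hi.1, ?_⟩
        have hil : i ≠ l := fun h => hlB (h ▸ hi.1)
        by_cases hik : i = k
        · exact hik ▸ hk
        · simpa [Equiv.swap_apply_of_ne_of_ne hik hil] using hi.2
    · intro i hi
      rw [mem_filter] at hi ⊢
      refine ⟨hi.1, ?_⟩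
      have hik : i ≠ k := fun h => (mem_sdiff.1 hi.1).2 (h ▸ hkB)
      by_cases hil : i = l
      · have := hi.2
        simp [hil] at this
        linarith
      · simpa [Equiv.swap_apply_of_ne_of_ne hik hil] using hi.2
  by_cases h2 : ∃ k ∈ K \ B, 0 < x k
  · obtain ⟨k, hkKB, hk⟩ := h2
    have hkK := (mem_sdiff.1 hkKB).1
    have hkB := (mem_sdiff.1 hkKB).2
    obtain ⟨l, hl, hl0⟩ := exists_mem_apply_eq_zero (hT.card_support_le x hx) hJB hk.ne'
      (by simpa [hkB] using disjoint_right.1 hJK hkK)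
    have hln : l < n := by
      rcases mem_union.1 hl with h | h
      · exact mem_range.1 (hJn h)
      · exact mem_range.1 (hKn (hBK h))
    have hzl : z l ≤ θ := by
      rcases mem_union.1 hl with h | h
      · rw [hzJ l h]; exact hJ l h
      · rw [hzK l (hBK h)]
    have hlKB : l ∉ K \ B := by
      rcases mem_union.1 hl with h | h
      · exact fun h' => disjoint_left.1 hJK h (mem_sdiff.1 h').1
      · simp [h]
    have hkl : k ≠ l := fun h => hlKB (h ▸ hkKB)
    have hmem := hT.invariant _ (swap_mem_symGroup (mem_range.1 (hKn hkK)) hln) x hx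
    have hval := pairing_swap z k l x
    rw [hzK k hkK, hl0] at hval
    have hle : 0 ≤ pairing z (Finsupp.equivMapDomain (Equiv.swap k l) x) := by
      refine ih _ ?_ _ hmem rfl
      rw [← hN]
      refine add_lt_add_of_le_of_lt (card_le_card ?_) (card_lt_card ?_)
      · intro i hi
        rw [mem_filter] at hi ⊢
        refine ⟨hi.1, ?_⟩
        have hik : i ≠ k := fun h => hkB (h ▸ hi.1)
        by_cases hil : i = l
        · have := hi.2
          simp [hil] at this
          linarith
        · simpa [Equiv.swap_apply_of_ne_of_ne hik hil] using hi.2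
      · rw [Finset.ssubset_iff_of_subset]
        · exact ⟨k, by simpa [hkKB] using hk, by rw [mem_filter]; simp [hl0]⟩
        · intro i hi
          rw [mem_filter] at hi ⊢
          refine ⟨hi.1, ?_⟩
          have hil : i ≠ l := fun h => hlKB (h ▸ hi.1)
          by_cases hik : i = k
          · exact hik ▸ hk
          · simpa [Equiv.swap_apply_of_ne_of_ne hik hil] using hi.2
    nlinarith
  -- No wrong signs remain: average over the powers of a cycle on `B`.
  push Not at h1 h2
  have hBn : B ⊆ range n := hBK.trans hKn
  obtain ⟨σ, hσ, hσB⟩ := (Set.Finite.countable B.finite_toSet).exists_cycleOn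
  have hfix : ∀ i ∉ B, σ i = i := fun i hi => by
    by_contra h
    exact hi (hσB h)
  have hσn : σ ∈ symGroup n := mem_symGroup.2 fun i hi =>
    hfix i fun h => absurd (mem_range.1 (hBn h)) (not_lt.2 hi)
  have hsum : 0 ≤ ∑ k ∈ range B.card, pairing (y ∘ (σ ^ k : Equiv.Perm ℕ)) x :=
    sum_nonneg fun k _ => by
      rw [← pairing_equivMapDomain]
      exact hy _ (hT.invariant _ (pow_mem hσn k) x hx)
  rw [sum_cycle_pairing (hT.vanish x hx) y hBn hσ hfix, ← hθ] at hsum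
  have hBpos : (0 : ℝ) < B.card := by exact_mod_cast hB.card_pos
  have hsum' : 0 ≤ ∑ i ∈ range n \ B, x i * y i + ∑ i ∈ B, x i * θ := by
    rw [← sum_mul]
    by_contra! h
    nlinarith
  rw [pairing_eq_sum_range _ (hT.vanish x hx), ← sum_sdiff hBn]
  refine hsum'.trans (add_le_add (sum_le_sum fun i hi => ?_) (sum_le_sum fun i hi => ?_))
  · by_cases hiK : i ∈ K
    · have hiKB : i ∈ K \ B := mem_sdiff.2 ⟨hiK, (mem_sdiff.1 hi).2⟩
      rw [hzK i hiK]
      exact mul_le_mul_of_nonpos_left (hK i hiKB) (h2 i hiKB)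
    · simp [hz, hiK]
  · rw [hzK i (hBK hi)]

/-! ### Merging the two least positive coordinates -/

/-- The `r` elements with the least values. -/
theorem exists_subset_card_eq_forall_le {ι α : Type*} [DecidableEq ι] [LinearOrder α] (y : ι → α)
    (S : Finset ι) (r : ℕ) (hr : r ≤ S.card) :
    ∃ R ⊆ S, R.card = r ∧ ∀ a ∈ R, ∀ b ∈ S \ R, y a ≤ y b := by
  induction r with
  | zero => exact ⟨∅, by simp, by simp, by simp⟩
  | succ r ih =>
    obtain ⟨R, hRS, hR, h⟩ := ih (by omega)
    have hne : (S \ R).Nonempty := by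
      rw [← card_pos, card_sdiff_of_subset hRS]
      omega
    obtain ⟨m, hm, hmin⟩ := exists_min_image (S \ R) y hne
    refine ⟨insert m R, insert_subset (mem_sdiff.1 hm).1 hRS, ?_, ?_⟩
    · rw [card_insert_of_notMem (mem_sdiff.1 hm).2, hR]
    · intro a ha b hb
      have hb' : b ∈ S \ R := by
        simp only [mem_sdiff, mem_insert, not_or] at hb ⊢
        exact ⟨hb.1, hb.2.2⟩
      rcases mem_insert.1 ha with rfl | ha
      · exact hmin b hb'
      · exact h a ha b hb'

/-- A functional that is nonnegative on `T` and negative at `u` can be chosen to be sorted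
oppositely to `u`. -/
theorem exists_antivary_pairing_neg {n r : ℕ} {T : Set (ℕ →₀ ℝ)} (hT : IsSparseSymSet n r T)
    {u : ℕ →₀ ℝ} (hu : u ∉ PointedCone.hull ℝ T) :
    ∃ y : ℕ → ℝ, (∀ x ∈ T, 0 ≤ pairing y x) ∧ pairing y u < 0 ∧
      ∀ k < n, ∀ l < n, u l < u k → y k ≤ y l := by
  obtain ⟨y, hy, hyu⟩ := exists_pairing_neg hT.finite hu
  -- Rearrangement: at a minimizer over `Sym(n)`, a pair ordered the wrong way could be swapped to
  -- lower the value.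
  obtain ⟨σ, hσ⟩ := Finite.exists_min (fun σ : symGroup n => pairing (y ∘ σ.1) u)
  refine ⟨y ∘ σ.1, fun x hx => ?_, ?_, fun k hk l hl hkl => ?_⟩
  · rw [← pairing_equivMapDomain]
    exact hy _ (hT.invariant _ σ.2 x hx)
  · have := hσ 1
    exact lt_of_le_of_lt this hyu
  · by_contra! h
    have h1 := hσ ⟨σ.1 * Equiv.swap k l, mul_mem σ.2 (swap_mem_symGroup hk hl)⟩
    have h2 : pairing (y ∘ (σ.1 * Equiv.swap k l : Equiv.Perm ℕ)) u =
        pairing (y ∘ σ.1) u + (u l - u k) * ((y ∘ σ.1) k - (y ∘ σ.1) l) := by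
      rw [← pairing_swap, pairing_equivMapDomain]
      rfl
    simp only [h2] at h1
    nlinarith

/-- The main case of merging, where `i` is among the `r` indices of `P` with least `y`. A functional
`z` equal to a constant `θ` on a set containing `i` and `j` does not see the merge, so it is
nonnegative at the merged vector `v`; a count then shows that `y` is at least `z` at `v`. -/
theorem merge_aux {n r : ℕ} {T : Set (ℕ →₀ ℝ)} (hT : IsSparseSymSet n r T) {y : ℕ → ℝ}
    (hy : ∀ x ∈ T, 0 ≤ pairing y x) {u : ℕ →₀ ℝ} (hu : u ∈ PointedCone.hull ℝ T)
    {i j : ℕ} (hij : i ≠ j) {P R : Finset ℕ} (hPn : P ⊆ range n) (hj : j ∈ P)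
    (hRP : R ⊆ P.erase j) (hPr : 2 * r ≤ P.card) (hR : R.card = r) (hiR : i ∈ R)
    (huj : 0 ≤ u j) (hji : u j ≤ u i)
    (hmin : ∀ k ∈ P, k ≠ j → u i ≤ u k)
    (hRmin : ∀ a ∈ R, ∀ b ∈ P \ R, y a ≤ y b)
    (hanti : ∀ k ∈ R, k ≠ i → u i + u j < u k → ∀ l ∈ R, l = i ∨ u l ≤ u i + u j → y k ≤ y l) :
    0 ≤ pairing y (u + (Finsupp.single i (u j) - Finsupp.single j (u j))) := by
  set t := u i + u j with ht
  set v := u + (Finsupp.single i (u j) - Finsupp.single j (u j)) with hv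
  have hvi : v i = t := by simp [hv, hij.symm, ht]
  have hvj : v j = 0 := by simp [hv, hij]
  have hvk : ∀ k, k ≠ i → k ≠ j → v k = u k := fun k hi hj => by simp [hv, hi.symm, hj.symm]
  have hRP' : R ⊆ P := hRP.trans (erase_subset _ _)
  have hjR : j ∉ R := fun h => (mem_erase.1 (hRP h)).1 rfl
  -- `J` holds the indices of `R` whose entry exceeds the merged one. They are left out of the
  -- averaging, so that entries on `B` are at most `t`; `hanti` keeps `y` on `J` below the mean over
  -- `B`.
  set J := R.filter (fun k => t < v k) with hJ
  set B := R \ J with hB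
  set K := P \ J with hK
  have hiJ : i ∉ J := by simp [hJ, hvi]
  have hiB : i ∈ B := mem_sdiff.2 ⟨hiR, hiJ⟩
  have hJR : J ⊆ R := filter_subset _ _
  have hBR : B ⊆ R := sdiff_subset
  have hjJ : j ∉ J := fun h => hjR (hJR h)
  have hBK : B ⊆ K := sdiff_subset_sdiff hRP' subset_rfl
  have hKB : K \ B = P \ R := by
    ext k
    simp only [hK, hB, mem_sdiff]
    constructor
    · rintro ⟨⟨h1, h2⟩, h3⟩
      exact ⟨h1, fun h => h3 ⟨h, h2⟩⟩
    · rintro ⟨h1, h2⟩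
      exact ⟨⟨h1, fun h => h2 (hJR h)⟩, fun h => h2 h.1⟩
  have hBpos : (0 : ℝ) < B.card := by exact_mod_cast card_pos.2 ⟨i, hiB⟩
  set θ := (∑ k ∈ B, y k) / B.card with hθ
  have hθ' : θ * B.card = ∑ k ∈ B, y k := div_mul_cancel₀ _ hBpos.ne'
  have hle : ∀ c, (∀ k ∈ B, c ≤ y k) → c ≤ θ := fun c hc => by
    rw [hθ, le_div_iff₀ hBpos, mul_comm, ← nsmul_eq_mul]
    exact card_nsmul_le_sum _ _ _ hc
  have hge : ∀ c, (∀ k ∈ B, y k ≤ c) → θ ≤ c := fun c hc => by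
    rw [hθ, div_le_iff₀ hBpos, mul_comm, ← nsmul_eq_mul]
    exact sum_le_card_nsmul _ _ _ hc
  have hvB : ∀ k ∈ B, v k ≤ t := fun k hk => by
    by_contra! h
    exact (mem_sdiff.1 hk).2 (mem_filter.2 ⟨hBR hk, h⟩)
  have hcardPR : (P \ R).card = P.card - r := by rw [card_sdiff_of_subset hRP', hR]
  have hz := pairing_mean_nonneg hT hy (J := J) (B := B) (K := K)
    ((hJR.trans hRP').trans hPn) (sdiff_subset.trans hPn) hBK disjoint_sdiff
    (by rw [hB, union_sdiff_of_subset hJR, hR]) (by rw [hKB, hcardPR]; omega) ⟨i, hiB⟩ hθ'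
    (fun l hl => hle _ fun k hk => by
      have hlJ := mem_filter.1 hl
      have hli : l ≠ i := fun h => hiJ (h ▸ hl)
      have hlj : l ≠ j := fun h => hjJ (h ▸ hl)
      refine hanti l hlJ.1 hli (by rw [← hvk l hli hlj]; exact hlJ.2) k (hBR hk) ?_
      by_cases hki : k = i
      · exact Or.inl hki
      · right
        rw [← hvk k hki (fun h => hjR (h ▸ hBR hk))]
        exact hvB k hk)
    (fun k hk => hge _ fun b hb => hRmin b (hBR hb) k (hKB ▸ hk))
  have hzu := pairing_nonneg_of_mem_hull hz hu
  set z : ℕ → ℝ := fun k => if k ∈ K then θ else y k with hzdef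
  have hiK : i ∈ K := hBK hiB
  have hjK : j ∈ K := mem_sdiff.2 ⟨hj, hjJ⟩
  have hzv : pairing z v = pairing z u := by
    rw [hv, map_add, map_sub, pairing_single, pairing_single]
    simp [hzdef, hiK, hjK]
  refine (hzv ▸ hzu).trans ?_
  rw [← sub_nonneg]
  have hvn : ∀ k, n ≤ k → v k = 0 := by
    intro k hk
    have huk : u k = 0 := by
      have hle : PointedCone.hull ℝ T ≤
          (PointedCone.ofSubmodule (LinearMap.ker (Finsupp.lapply (R := ℝ) (M := ℝ) k))) :=
        Submodule.span_le.2 fun x hx => by simpa using hT.vanish x hx k hk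
      simpa using hle hu
    have hki : k ≠ i := fun h => absurd (mem_range.1 (hPn (hRP' hiR))) (by omega)
    have hkj : k ≠ j := fun h => absurd (mem_range.1 (hPn hj)) (by omega)
    rw [hvk k hki hkj, huk]
  rw [pairing_eq_sum_range _ hvn, pairing_eq_sum_range _ hvn, ← sum_sub_distrib]
  have hKn : K ⊆ range n := sdiff_subset.trans hPn
  rw [← sum_sdiff hKn, sum_eq_zero fun k hk => by simp [hzdef, (mem_sdiff.1 hk).2], zero_add,
    ← sum_sdiff hBK, hKB, ← sum_erase (P \ R) (a := j) (by simp [hvj])]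
  obtain ⟨m, hmB, hm⟩ := exists_max_image B y ⟨i, hiB⟩
  set M := y m - θ with hM
  have hM0 : 0 ≤ M := sub_nonneg.2 (hge _ hm)
  have ht0 : 0 ≤ t := by rw [ht]; linarith
  -- Since `u j ≤ u i`, the second least entry `u i` is at least `t / 2`.
  have hlow : ∀ k ∈ P, k ≠ j → t / 2 ≤ v k := by
    intro k hk hkj
    by_cases hki : k = i
    · rw [hki, hvi]; linarith
    · rw [hvk k hki hkj]
      have := hmin k hk hkj
      linarith
  have hsum1 : (((P \ R).erase j).card : ℝ) * (M * (t / 2)) ≤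
      ∑ k ∈ (P \ R).erase j, (v k * y k - v k * z k) := by
    rw [← nsmul_eq_mul]
    refine card_nsmul_le_sum _ _ _ fun k hk => ?_
    have hkj := (mem_erase.1 hk).1
    have hkPR := (mem_erase.1 hk).2
    have hkP := (mem_sdiff.1 hkPR).1
    have hkK : k ∈ K := (mem_sdiff.1 (hKB ▸ hkPR)).1
    have h1 := hlow k hkP hkj
    have h2 : M ≤ y k - θ := by
      have := hRmin m (hBR hmB) k hkPR
      linarith
    simp only [hzdef, hkK, if_true]
    rw [← mul_sub, mul_comm]
    exact mul_le_mul h1 h2 hM0 (by linarith)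
  have hsum2 : -(((B.erase i).card : ℝ) * (M * (t / 2))) ≤
      ∑ k ∈ B, (v k * y k - v k * z k) := by
    -- `θ` is the mean over `B`, so subtracting the constant `t` from `v` changes nothing. What is
    -- left has coefficients in `[-t/2, 0]`, and the term at `i` vanishes.
    have h1 : ∑ k ∈ B, t * (y k - θ) = 0 := by
      rw [← mul_sum, sum_sub_distrib, ← hθ']
      simp [mul_comm]
    have h2 : ∑ k ∈ B, (v k * y k - v k * z k) =
        ∑ k ∈ B.erase i, (v k - t) * (y k - θ) := by
      rw [sum_erase (a := i) B (by simp [hvi])]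
      rw [← sub_zero (∑ k ∈ B, (v k * y k - v k * z k)), ← h1, ← sum_sub_distrib]
      refine sum_congr rfl fun k hk => ?_
      simp only [hzdef, hBK hk, if_true]
      ring
    rw [h2, ← mul_neg, ← nsmul_eq_mul]
    refine card_nsmul_le_sum _ _ _ fun k hk => ?_
    have hkB := (mem_erase.1 hk).2
    have h3 := hlow k (hRP' (hBR hkB)) (fun h => hjR (h ▸ hBR hkB))
    have h4 := hvB k hkB
    have h5 : y k - θ ≤ M := by
      have := hm k hkB
      linarith
    nlinarith
  -- Here `2r ≤ |P|` enters: the loss has at most `r - 1` terms, the gain `|P| - r - 1` terms, each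
  -- bounded by the same `M * (t / 2)`.
  have hcard : ((B.erase i).card : ℝ) ≤ ((P \ R).erase j).card := by
    have h1 : (B.erase i).card ≤ r - 1 := by
      rw [card_erase_of_mem hiB]
      have := card_le_card hBR
      omega
    have h2 : ((P \ R).erase j).card = P.card - r - 1 := by
      rw [card_erase_of_mem (mem_sdiff.2 ⟨hj, hjR⟩), hcardPR]
    exact_mod_cast (by omega : (B.erase i).card ≤ ((P \ R).erase j).card)
  have := mul_le_mul_of_nonneg_right hcard (mul_nonneg hM0 (by linarith : 0 ≤ t / 2))
  linarith

/-- Merging the two least of at least `2 r` positive coordinates does not leave the cone. -/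
theorem merge_mem_hull {n r : ℕ} {T : Set (ℕ →₀ ℝ)} (hT : IsSparseSymSet n r T) (hr : 1 ≤ r)
    {u : ℕ →₀ ℝ} (hu : u ∈ PointedCone.hull ℝ T) {P : Finset ℕ} (hPn : P ⊆ range n)
    (hPr : 2 * r ≤ P.card) {i j : ℕ} (hi : i ∈ P) (hj : j ∈ P) (hij : i ≠ j)
    (hpos : 0 < u j) (hji : u j ≤ u i) (hmin : ∀ k ∈ P, k ≠ j → u i ≤ u k) :
    u + (Finsupp.single i (u j) - Finsupp.single j (u j)) ∈ PointedCone.hull ℝ T := by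
  by_contra hcon
  obtain ⟨y, hy, hyv, hanti⟩ := exists_antivary_pairing_neg hT hcon
  set v := u + (Finsupp.single i (u j) - Finsupp.single j (u j)) with hv
  have hvi : v i = u i + u j := by simp [hv, hij.symm]
  have hvj : v j = 0 := by simp [hv, hij]
  have hvk : ∀ k, k ≠ i → k ≠ j → v k = u k := fun k hi hj => by simp [hv, hi.symm, hj.symm]
  have hvpos : ∀ k ∈ P, k ≠ j → 0 < v k := by
    intro k hk hkj
    by_cases hki : k = i
    · rw [hki, hvi]; linarith
    · rw [hvk k hki hkj]
      have := hmin k hk hkj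
      linarith
  have hyu := pairing_nonneg_of_mem_hull hy hu
  have hyv' : pairing y v = pairing y u + u j * (y i - y j) := by
    rw [hv, map_add, map_sub, pairing_single, pairing_single]
    ring
  obtain ⟨R, hRP, hR, hRmin⟩ := exists_subset_card_eq_forall_le y (P.erase j) r
    (by rw [card_erase_of_mem hj]; omega)
  have hRP' : R ⊆ P := hRP.trans (erase_subset _ _)
  have hjR : j ∉ R := fun h => (mem_erase.1 (hRP h)).1 rfl
  have hjn := mem_range.1 (hPn hj)
  by_cases hiR : i ∈ R
  · refine absurd (merge_aux hT hy hu hij hPn hj hRP hPr hR hiR hpos.le hji hmin ?_ ?_)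
      (not_le.2 hyv)
    · intro a ha b hb
      by_cases hbj : b = j
      · subst hbj
        refine hanti a (mem_range.1 (hPn (hRP' ha))) b hjn ?_
        rw [hvj]
        exact hvpos a (hRP' ha) (fun h => hjR (h ▸ ha))
      · exact hRmin a ha b (mem_sdiff.2 ⟨mem_erase.2 ⟨hbj, (mem_sdiff.1 hb).1⟩,
          (mem_sdiff.1 hb).2⟩)
    · intro k hk hki hkt l hl hlt
      refine hanti k (mem_range.1 (hPn (hRP' hk))) l (mem_range.1 (hPn (hRP' hl))) ?_
      rw [hvk k hki (fun h => hjR (h ▸ hk))]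
      by_cases hli : l = i
      · rwa [hli, hvi]
      · rw [hvk l hli (fun h => hjR (h ▸ hl))]
        rcases hlt with h | h
        · exact absurd h hli
        · linarith
  -- If `i ∉ R`, lowering `y j` to `y i` keeps the functional nonnegative on `T`: where `x j > 0`,
  -- swap `j` with a zero of `x` in `R`. Its value at `u` is that of `y` at `v`, which is negative.
  · have hyij : y i < y j := by
      by_contra! h
      nlinarith
    have hz : ∀ x ∈ T, 0 ≤ pairing (Function.update y j (y i)) x := by
      intro x hx
      rw [pairing_update]
      have hyx := hy x hx
      by_cases hxj : x j ≤ 0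
      · nlinarith
      · push Not at hxj
        obtain ⟨l, hlR, hl⟩ := exists_mem_apply_eq_zero (hT.card_support_le x hx) hR.ge hxj.ne' hjR
        have h1 := hy _ (hT.invariant _ (swap_mem_symGroup hjn
          (mem_range.1 (hPn (hRP' hlR)))) x hx)
        rw [pairing_swap, hl] at h1
        have h2 := hRmin l hlR i (mem_sdiff.2 ⟨mem_erase.2 ⟨hij, hi⟩, hiR⟩)
        nlinarith
    have := pairing_nonneg_of_mem_hull hz hu
    rw [pairing_update] at this
    linarith

/-! ### Saturation of the cones -/

/-- Supplies the value of a separating functional at a new coordinate: there are `r` old coordinates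
on either side, so a generator of either sign at the new coordinate can be swapped into a zero on
the favourable side. -/
theorem exists_median {n r : ℕ} (hr : 1 ≤ r) (hn : 2 * r ≤ n) (y : ℕ → ℝ) :
    ∃ m, r ≤ ((range n).filter (fun k => y k ≤ m)).card ∧
      r ≤ ((range n).filter (fun k => m ≤ y k)).card := by
  obtain ⟨R, hRn, hR, hmin⟩ := exists_subset_card_eq_forall_le y (range n) r (by simp; omega)
  obtain ⟨m, hmR, hm⟩ := exists_max_image R y (card_pos.1 (by omega))
  refine ⟨y m, hR.ge.trans (card_le_card fun k hk => ?_), ?_⟩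
  · exact mem_filter.2 ⟨hRn hk, hm k hk⟩
  · have : (range n \ R).card = n - r := by rw [card_sdiff_of_subset hRn, hR, card_range]
    refine (by omega : r ≤ (range n \ R).card).trans (card_le_card fun k hk => ?_)
    exact mem_filter.2 ⟨(mem_sdiff.1 hk).1, hmin m hmR k hk⟩

/-- The permutation may be altered by swapping `n` with its preimage, since `u` is zero at both. -/
theorem mem_symOrbit_of_mem_symOrbit_succ {n : ℕ} {A : Set (ℕ →₀ ℝ)}
    (hA : ∀ x ∈ A, ∀ i, n ≤ i → x i = 0) {x : ℕ →₀ ℝ} (hx : x ∈ symOrbit (n + 1) A)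
    (hxn : x n = 0) : x ∈ symOrbit n A := by
  obtain ⟨σ, hσ, u, hu, rfl⟩ := hx
  set q := σ.symm n with hq
  have hσq : σ q = n := by simp [hq]
  have hqn : q ≤ n := by
    by_contra! h
    have := mem_symGroup.1 hσ q h
    omega
  refine ⟨σ * Equiv.swap q n, ?_, u, hu, ?_⟩
  · refine mem_symGroup.2 fun i hi => ?_
    rcases hi.eq_or_lt with rfl | hi
    · simp [hσq]
    · rw [Equiv.Perm.mul_apply, Equiv.swap_apply_of_ne_of_ne (by omega) (by omega)]
      exact mem_symGroup.1 hσ i hi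
  · rw [equivMapDomain_mul, equivMapDomain_swap]
    have h1 : u q = 0 := by simpa using hxn
    rw [h1, hA u hu n le_rfl]
    simp

/-- The cones generated by the orbits are saturated from `n = 2 r` on. -/
theorem mem_hull_symOrbit_of_succ {n r : ℕ} (hr : 1 ≤ r) (hn : 2 * r ≤ n) {A : Set (ℕ →₀ ℝ)}
    (hA : A.Finite) (hAr : ∀ x ∈ A, ∀ i, r ≤ i → x i = 0) {u : ℕ →₀ ℝ}
    (hu : u ∈ PointedCone.hull ℝ (symOrbit (n + 1) A)) (hun : u n = 0) :
    u ∈ PointedCone.hull ℝ (symOrbit n A) := by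
  by_contra hcon
  obtain ⟨y, hy, hyu⟩ := exists_pairing_neg (finite_symOrbit n hA) hcon
  obtain ⟨m, hm1, hm2⟩ := exists_median hr hn y
  have hAn : ∀ x ∈ A, ∀ i, n ≤ i → x i = 0 := fun x hx i hi => hAr x hx i (by omega)
  have hT := isSparseSymSet_symOrbit (n := n + 1) (by omega) hA hAr
  have hkey : ∀ x ∈ symOrbit (n + 1) A, ∀ l < n, x l = 0 →
      0 ≤ pairing (Function.update y n m) x + x n * (y l - m) := by
    intro x hx l hl hxl
    have h1 := hT.invariant _ (swap_mem_symGroup (n := n + 1) (k := n) (l := l) (by omega)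
      (by omega)) x hx
    have h2 := hy _ (mem_symOrbit_of_mem_symOrbit_succ hAn h1 (by simpa using hxl))
    rw [pairing_swap, hxl] at h2
    rw [pairing_update]
    linarith
  have hz : ∀ x ∈ symOrbit (n + 1) A, 0 ≤ pairing (Function.update y n m) x := by
    intro x hx
    rcases lt_trichotomy (x n) 0 with h | h | h
    · obtain ⟨l, hl, hxl⟩ := exists_mem_apply_eq_zero (hT.card_support_le x hx) hm2 h.ne (by simp)
      rw [mem_filter, mem_range] at hl
      have := hkey x hx l hl.1 hxl
      nlinarith [hl.2]
    · rw [pairing_update, h, zero_mul, add_zero]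
      exact hy x (mem_symOrbit_of_mem_symOrbit_succ hAn hx h)
    · obtain ⟨l, hl, hxl⟩ := exists_mem_apply_eq_zero (hT.card_support_le x hx) hm1 h.ne' (by simp)
      rw [mem_filter, mem_range] at hl
      have := hkey x hx l hl.1 hxl
      nlinarith [hl.2]
  have := pairing_nonneg_of_mem_hull hz hu
  rw [pairing_update, hun] at this
  linarith

/-! ### Lattice points, gradings and Hilbert bases -/

theorem intToReal_apply (u : ℕ →₀ ℤ) (i : ℕ) : intToReal u i = (u i : ℝ) := rfl

theorem intToReal_single (i : ℕ) (c : ℤ) :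
    intToReal (Finsupp.single i c) = Finsupp.single i (c : ℝ) := by
  simp [intToReal]

theorem intToReal_equivMapDomain (σ : Equiv.Perm ℕ) (u : ℕ →₀ ℤ) :
    intToReal (Finsupp.equivMapDomain σ u) = Finsupp.equivMapDomain σ (intToReal u) := by
  ext i
  rfl

theorem intToReal_injective : Function.Injective intToReal := fun u v h => by
  ext i
  have := DFunLike.congr_fun h i
  simpa [intToReal_apply] using this

theorem mem_latticePoints {C : PointedCone ℝ (ℕ →₀ ℝ)} {u : ℕ →₀ ℤ} :
    u ∈ latticePoints C ↔ intToReal u ∈ C := Iff.rfl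

theorem equivMapDomain_mem {C : PointedCone ℝ (ℕ →₀ ℝ)} {n : ℕ}
    (hinv : symOrbit n (C : Set (ℕ →₀ ℝ)) ⊆ C) {σ : Equiv.Perm ℕ} (hσ : σ ∈ symGroup n)
    {u : ℕ →₀ ℝ} (hu : u ∈ C) : Finsupp.equivMapDomain σ u ∈ C :=
  hinv ⟨σ, hσ, u, hu, rfl⟩

/-- A nonzero vector of a pointed symmetric cone has a nonzero sum of coordinates. -/
theorem eq_zero_of_pairing_one_eq_zero {C : PointedCone ℝ (ℕ →₀ ℝ)} {n : ℕ} (hn : 1 ≤ n)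
    (hinv : symOrbit n (C : Set (ℕ →₀ ℝ)) ⊆ C) (hvan : ∀ u ∈ C, ∀ i, n ≤ i → u i = 0)
    (hC : IsPointed C) {u : ℕ →₀ ℝ} (hu : u ∈ C) (h0 : pairing (fun _ => 1) u = 0) : u = 0 := by
  obtain ⟨σ, hσ, hσB⟩ := (Set.Finite.countable (range n).finite_toSet).exists_cycleOn
  have hfix : ∀ i ∉ range n, σ i = i := fun i hi => by
    by_contra h
    exact hi (hσB h)
  have hσn : σ ∈ symGroup n := mem_symGroup.2 fun i hi => hfix i (by simpa using hi)
  have hmem : ∀ k : ℕ, Finsupp.equivMapDomain (σ ^ k : Equiv.Perm ℕ) u ∈ C := fun k =>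
    equivMapDomain_mem hinv (pow_mem hσn k) hu
  -- The sum of the cyclic images has all coordinates equal to the coordinate sum of `u`, which is
  -- zero; so `-u` is the sum of the nontrivial images.
  have hsum : ∑ k ∈ range n, Finsupp.equivMapDomain (σ ^ k : Equiv.Perm ℕ) u = 0 := by
    ext i
    have hvan' := hvan _ (sum_mem fun k (_ : k ∈ range n) => hmem k)
    by_cases hi : n ≤ i
    · exact hvan' i hi
    · have h1 := sum_cycle_pairing (hvan u hu) (fun j => if j = i then 1 else 0)
        (subset_refl _) hσ hfix
      have h2 := pairing_eq_sum_range (fun _ => (1 : ℝ)) (hvan u hu)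
      simp only [mul_one] at h2
      rw [Finset.sdiff_self, sum_empty, mul_zero, zero_add, ← h2, h0, zero_mul, card_range] at h1
      simp only [← pairing_equivMapDomain, ← map_sum] at h1
      rw [pairing_eq_sum_range _ hvan'] at h1
      simpa [not_le.1 hi] using h1
  obtain ⟨m, rfl⟩ : ∃ m, n = m + 1 := ⟨n - 1, by omega⟩
  rw [sum_range_succ', pow_zero] at hsum
  have h1 : Finsupp.equivMapDomain (1 : Equiv.Perm ℕ) u = u := by
    ext i
    rfl
  rw [h1] at hsum
  have hneg : -u ∈ C := by
    rw [← eq_neg_of_add_eq_zero_left hsum]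
    exact sum_mem fun k _ => hmem (k + 1)
  have : u ∈ C.lineal := ⟨hu, hneg⟩
  rwa [hC, Submodule.mem_bot] at this

theorem pairing_one_intToReal (u : ℕ →₀ ℤ) :
    pairing (fun _ => 1) (intToReal u) = ((u.sum fun _ a => a : ℤ) : ℝ) := by
  induction u using Finsupp.induction_linear with
  | zero => simp
  | add u v hu hv =>
    rw [map_add, map_add, hu, hv, Finsupp.sum_add_index' (by simp) (by simp)]
    push_cast
    rfl
  | single i c => simp [intToReal_single, pairing_single]

/-- A pointed symmetric cone has an integral grading that is positive off `0`. -/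
theorem exists_grading {C : PointedCone ℝ (ℕ →₀ ℝ)} {n : ℕ} (hn : 1 ≤ n)
    (hinv : symOrbit n (C : Set (ℕ →₀ ℝ)) ⊆ C) (hvan : ∀ u ∈ C, ∀ i, n ≤ i → u i = 0)
    (hC : IsPointed C) :
    ∃ f : (ℕ →₀ ℤ) →+ ℤ, ∀ u ∈ latticePoints C, u ≠ 0 → 0 < f u := by
  have hne : ∀ u ∈ C, u ≠ 0 → pairing (fun _ => 1) u ≠ 0 := fun u hu hu0 h =>
    hu0 (eq_zero_of_pairing_one_eq_zero hn hinv hvan hC hu h)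
  let f : (ℕ →₀ ℤ) →+ ℤ := Finsupp.liftAddHom fun _ => AddMonoidHom.id ℤ
  have hf : ∀ u, ((f u : ℤ) : ℝ) = pairing (fun _ => 1) (intToReal u) := fun u => by
    rw [pairing_one_intToReal]
    rfl
  have h0 : ∀ u : ℕ →₀ ℤ, u ≠ 0 → intToReal u ≠ 0 := fun u hu h =>
    hu (intToReal_injective (by rw [h, map_zero]))
  by_cases hpos : ∃ u ∈ C, 0 < pairing (fun _ => 1) u
  · obtain ⟨u, hu, hup⟩ := hpos
    refine ⟨f, fun v hv hv0 => ?_⟩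
    rcases lt_or_gt_of_ne (hne _ hv (h0 v hv0)) with h | h
    -- Two vectors with coordinate sums of opposite sign have a positive combination of sum zero,
    -- which vanishes by pointedness. Hence one sign prevails on the cone.
    · have hw : pairing (fun _ => 1) ((-pairing (fun _ => 1) (intToReal v)) • u +
          pairing (fun _ => 1) u • intToReal v) = 0 := by
        simp only [map_add, map_smul, smul_eq_mul]
        ring
      have hw0 := eq_zero_of_pairing_one_eq_zero hn hinv hvan hC (add_mem
        (PointedCone.smul_mem C (neg_pos.2 h).le hu) (PointedCone.smul_mem C hup.le hv)) hw
      have hneg : -((pairing (fun _ => 1) u) • intToReal v) ∈ C := by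
        rw [← eq_neg_of_add_eq_zero_left hw0]
        exact PointedCone.smul_mem C (neg_pos.2 h).le hu
      have hl : (pairing (fun _ => 1) u) • intToReal v ∈ C.lineal :=
        ⟨PointedCone.smul_mem C hup.le hv, hneg⟩
      rw [hC, Submodule.mem_bot] at hl
      exact absurd hl (smul_ne_zero hup.ne' (h0 v hv0))
    · rw [← hf] at h
      exact_mod_cast h
  · push Not at hpos
    refine ⟨-f, fun v hv hv0 => ?_⟩
    have h := lt_of_le_of_ne (hpos _ hv) (hne _ hv (h0 v hv0))
    rw [← hf] at h
    have : f v < 0 := by exact_mod_cast h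
    simpa using this

theorem closure_hilbertBasis {M : AddSubmonoid (ℕ →₀ ℤ)} {f : (ℕ →₀ ℤ) →+ ℤ}
    (hf : ∀ u ∈ M, u ≠ 0 → 0 < f u) : AddSubmonoid.closure (hilbertBasis M) = M := by
  refine le_antisymm (AddSubmonoid.closure_le.2 fun u hu => hu.1) ?_
  have H : ∀ N : ℕ, ∀ u ∈ M, (f u).toNat = N → u ∈ AddSubmonoid.closure (hilbertBasis M) := by
    intro N
    induction N using Nat.strong_induction_on with
    | _ N ih =>
    intro u hu hN
    by_cases hu0 : u = 0
    · rw [hu0]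
      exact zero_mem _
    by_cases h : ∃ v ∈ M, ∃ w ∈ M, u = v + w ∧ v ≠ 0 ∧ w ≠ 0
    · obtain ⟨v, hv, w, hw, rfl, hv0, hw0⟩ := h
      have h1 := hf v hv hv0
      have h2 := hf w hw hw0
      rw [map_add] at hN
      exact add_mem (ih _ (by omega) v hv rfl) (ih _ (by omega) w hw rfl)
    · push Not at h
      refine AddSubmonoid.subset_closure ⟨hu, hu0, fun v hv w hw huvw => ?_⟩
      by_cases hv0 : v = 0
      · exact Or.inl hv0
      · exact Or.inr (h v hv w hw huvw hv0)
  exact fun u hu => H _ u hu rfl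

theorem hilbertBasis_subset_of_closure_eq {M : AddSubmonoid (ℕ →₀ ℤ)} {A : Set (ℕ →₀ ℤ)}
    (hA : AddSubmonoid.closure A = M) : hilbertBasis M ⊆ A := by
  intro u hu
  have h : u ∈ AddSubmonoid.closure A := hA ▸ hu.1
  induction h using AddSubmonoid.closure_induction with
  | mem x hx => exact hx
  | zero => exact absurd rfl hu.2.1
  | add x y hx hy ihx ihy =>
    rcases hu.2.2 x (hA ▸ hx) y (hA ▸ hy) rfl with rfl | rfl
    · rw [zero_add] at hu ⊢
      exact ihy hu
    · rw [add_zero] at hu ⊢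
      exact ihx hu

/-- **Gordan's lemma**, for the irreducible lattice points of a rational cone. -/
theorem finite_hilbertBasis {C : PointedCone ℝ (ℕ →₀ ℝ)} (hC : IsFinGenRational C) :
    (hilbertBasis (latticePoints C)).Finite := by
  obtain ⟨A, hA, rfl⟩ := hC
  set A' := hA.toFinset with hA'
  have hAA : A = A' := by simp [hA']
  set b : ℕ →₀ ℤ := ∑ a ∈ A', a.mapRange (fun c => |c|) (by simp) with hb
  refine (hA.union (Set.finite_Icc (-b) b)).subset fun u hu => ?_
  obtain ⟨hu1, hu0, hirr⟩ := hu
  have hu2 := mem_latticePoints.1 hu1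
  rw [hAA, Submodule.mem_span_image_finset_iff_exists_fun] at hu2
  obtain ⟨c, hc⟩ := hu2
  -- A generator with coefficient at least `1` can be split off, so `u` equals it. Otherwise all
  -- relevant coefficients are below `1` and `u` lies in a bounded box.
  by_cases hbig : ∃ a : A', (a : ℕ →₀ ℤ) ≠ 0 ∧ 1 ≤ (c a : ℝ)
  · obtain ⟨a, ha0, ha⟩ := hbig
    left
    have haA : (a : ℕ →₀ ℤ) ∈ A := by rw [hAA]; exact a.2
    have hmem : ∀ a : A', intToReal a ∈ PointedCone.hull ℝ (intToReal '' A) := fun a =>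
      PointedCone.subset_hull ⟨a, by rw [hAA]; exact a.2, rfl⟩
    have hsub : u - a ∈ latticePoints (PointedCone.hull ℝ (intToReal '' A)) := by
      rw [mem_latticePoints, map_sub, ← hc, ← add_sum_erase _ _ (mem_univ a), add_sub_right_comm]
      have : c a • intToReal a - intToReal a = ((c a : ℝ) - 1) • intToReal a := by
        rw [sub_smul, one_smul]
        rfl
      rw [this]
      exact add_mem (PointedCone.smul_mem _ (by linarith) (hmem a))
        (sum_mem fun a' _ => Submodule.smul_mem _ _ (hmem a'))
    rcases hirr a (hmem a) (u - a) hsub (by abel) with h | h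
    · exact absurd h ha0
    · rw [sub_eq_zero.1 h]
      exact haA
  · push Not at hbig
    right
    have habs : ∀ i, |u i| ≤ b i := by
      intro i
      have h1 : ((|u i| : ℤ) : ℝ) ≤ ((b i : ℤ) : ℝ) := by
        have h2 : (u i : ℝ) = ∑ a : A', (c a : ℝ) * ((a : ℕ →₀ ℤ) i : ℝ) := by
          rw [← intToReal_apply, ← hc, Finsupp.finsetSum_apply]
          rfl
        rw [hb, Finsupp.finsetSum_apply, ← sum_coe_sort A']
        push_cast
        rw [h2]
        refine (abs_sum_le_sum_abs _ _).trans (sum_le_sum fun a _ => ?_)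
        rw [abs_mul, abs_of_nonneg (c a).2]
        by_cases ha : (a : ℕ →₀ ℤ) = 0
        · simp [ha]
        · simpa using mul_le_of_le_one_left (abs_nonneg _) (hbig a ha).le
      exact_mod_cast h1
    exact ⟨fun i => (abs_le.1 (habs i)).1, fun i => (abs_le.1 (habs i)).2⟩

/-! ### Merging for either sign, and norms -/

theorem neg_mem_hull_neg {T : Set (ℕ →₀ ℝ)} {u : ℕ →₀ ℝ} (hu : u ∈ PointedCone.hull ℝ T) :
    -u ∈ PointedCone.hull ℝ ((fun x => -x) '' T) := by
  have hle : PointedCone.hull ℝ T ≤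
      (PointedCone.hull ℝ ((fun x => -x) '' T)).comap (-LinearMap.id) :=
    Submodule.span_le.2 fun x hx => PointedCone.subset_hull ⟨x, hx, rfl⟩
  exact hle hu

theorem IsSparseSymSet.neg {n r : ℕ} {T : Set (ℕ →₀ ℝ)} (hT : IsSparseSymSet n r T) :
    IsSparseSymSet n r ((fun x => -x) '' T) where
  finite := hT.finite.image _
  vanish := by
    rintro _ ⟨x, hx, rfl⟩ i hi
    simp [hT.vanish x hx i hi]
  invariant := by
    rintro σ hσ _ ⟨x, hx, rfl⟩
    exact ⟨_, hT.invariant σ hσ x hx, by ext; rfl⟩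
  card_support_le := by
    rintro _ ⟨x, hx, rfl⟩
    simpa using hT.card_support_le x hx

theorem exists_merge_of_pos {n r : ℕ} {T : Set (ℕ →₀ ℝ)} (hT : IsSparseSymSet n r T) (hr : 1 ≤ r)
    {u : ℕ →₀ ℝ} (hu : u ∈ PointedCone.hull ℝ T)
    (hP : 2 * r ≤ ((range n).filter (fun k => 0 < u k)).card) :
    ∃ i < n, ∃ j < n, i ≠ j ∧ 0 < u i ∧ 0 < u j ∧
      u + (Finsupp.single i (u j) - Finsupp.single j (u j)) ∈ PointedCone.hull ℝ T := by
  set P := (range n).filter (fun k => 0 < u k) with hPdef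
  obtain ⟨j, hj, hjmin⟩ := exists_min_image P u (card_pos.1 (by omega))
  obtain ⟨i, hi, himin⟩ := exists_min_image (P.erase j) u
    (card_pos.1 (by rw [card_erase_of_mem hj]; omega))
  have hi' := mem_erase.1 hi
  have hiP := mem_filter.1 hi'.2
  have hjP := mem_filter.1 hj
  exact ⟨i, mem_range.1 hiP.1, j, mem_range.1 hjP.1, hi'.1, hiP.2, hjP.2,
    merge_mem_hull hT hr hu (filter_subset _ _) hP hi'.2 hj hi'.1 hjP.2 (hjmin i hi'.2)
      fun k hk hkj => himin k (mem_erase.2 ⟨hkj, hk⟩)⟩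

/-- Among `4r - 1` nonzero coordinates one sign occurs at least `2r` times; the negative case is the
positive one for `-T`. -/
theorem exists_merge {n r : ℕ} {T : Set (ℕ →₀ ℝ)} (hT : IsSparseSymSet n r T) (hr : 1 ≤ r)
    {u : ℕ →₀ ℝ} (hu : u ∈ PointedCone.hull ℝ T) (hfull : ∀ k < n, u k ≠ 0)
    (hn : 4 * r ≤ n + 1) :
    ∃ i < n, ∃ j < n, i ≠ j ∧ 0 < u i * u j ∧
      u + (Finsupp.single i (u j) - Finsupp.single j (u j)) ∈ PointedCone.hull ℝ T := by
  have hcard : ((range n).filter (fun k => 0 < u k)).card +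
      ((range n).filter (fun k => 0 < (-u) k)).card = n := by
    have h := card_filter_add_card_filter_not (s := range n) (fun k => 0 < u k)
    rw [card_range] at h
    have h2 : (range n).filter (fun k => ¬ 0 < u k) = (range n).filter (fun k => 0 < (-u) k) :=
      filter_congr fun k hk => by
        have := hfull k (mem_range.1 hk)
        simp only [Finsupp.coe_neg, Pi.neg_apply, Left.neg_pos_iff, not_lt]
        exact ⟨fun h => lt_of_le_of_ne h this, le_of_lt⟩
    rwa [h2] at h
  by_cases hP : 2 * r ≤ ((range n).filter (fun k => 0 < u k)).card
  · obtain ⟨i, hi, j, hj, hij, hui, huj, h⟩ := exists_merge_of_pos hT hr hu hP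
    exact ⟨i, hi, j, hj, hij, mul_pos hui huj, h⟩
  · obtain ⟨i, hi, j, hj, hij, hui, huj, h⟩ :=
      exists_merge_of_pos hT.neg hr (neg_mem_hull_neg hu) (by omega)
    refine ⟨i, hi, j, hj, hij, ?_, ?_⟩
    · have := mul_pos hui huj
      simpa using this
    · have h' := neg_mem_hull_neg h
      simp only [Set.image_image, neg_neg, Set.image_id'] at h'
      convert h' using 1
      simp only [Finsupp.coe_neg, Pi.neg_apply, Finsupp.single_neg]
      abel

/-- A coordinate can be distributed over itself and a vanishing one. -/
theorem spread_mem {C : PointedCone ℝ (ℕ →₀ ℝ)} {n : ℕ}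
    (hinv : symOrbit n (C : Set (ℕ →₀ ℝ)) ⊆ C) {v : ℕ →₀ ℝ} (hv : v ∈ C) {i j : ℕ} (hi : i < n)
    (hj : j < n) (hvj : v j = 0) {β : ℝ} (hβ : 0 ≤ β ∧ β ≤ v i ∨ v i ≤ β ∧ β ≤ 0) :
    v - Finsupp.single i β + Finsupp.single j β ∈ C := by
  by_cases hvi : v i = 0
  · have : β = 0 := by rcases hβ with h | h <;> linarith
    simpa [this] using hv
  have h1 : 0 ≤ β / v i := by
    rcases hβ with h | h
    · exact div_nonneg h.1 (h.1.trans h.2)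
    · exact div_nonneg_of_nonpos h.2 (h.1.trans h.2)
  have h2 : β / v i ≤ 1 := by
    rcases hβ with h | h
    · exact div_le_one_of_le₀ h.2 (h.1.trans h.2)
    · exact div_le_one_of_ge h.1 (h.1.trans h.2)
  have h3 := add_mem (PointedCone.smul_mem C (sub_nonneg.2 h2) hv) (PointedCone.smul_mem C h1
    (equivMapDomain_mem hinv (swap_mem_symGroup hi hj) hv))
  convert h3 using 1
  rw [equivMapDomain_swap, hvj, zero_sub, smul_sub, smul_add, sub_smul, one_smul,
    Finsupp.smul_single, Finsupp.smul_single, smul_eq_mul, mul_neg, div_mul_cancel₀ _ hvi,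
    Finsupp.single_neg, Finsupp.single_neg]
  abel

/-- Undoes a merge of `p` and `q` compatibly with a decomposition `a + b` of the merged entry: each
summand gives up a part lying between `0` and its own entry, as `spread_mem` requires. -/
theorem exists_split {a b p q : ℤ} (hab : a + b = p + q) (hpq : 0 < p * q) :
    ∃ β γ : ℤ, β + γ = q ∧ (0 ≤ β ∧ β ≤ a ∨ a ≤ β ∧ β ≤ 0) ∧
      (0 ≤ γ ∧ γ ≤ b ∨ b ≤ γ ∧ γ ≤ 0) := by
  have key : ∀ a b p q : ℤ, a + b = p + q → 0 < p → 0 < q →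
      ∃ β γ : ℤ, β + γ = q ∧ (0 ≤ β ∧ β ≤ a ∨ a ≤ β ∧ β ≤ 0) ∧
      (0 ≤ γ ∧ γ ≤ b ∨ b ≤ γ ∧ γ ≤ 0) := by
    intro a b p q hab hp hq
    by_cases ha : 0 ≤ a
    · by_cases haq : a ≤ q
      · exact ⟨a, q - a, by omega, by omega, by omega⟩
      · exact ⟨q, 0, by omega, by omega, by omega⟩
    · exact ⟨0, q, by omega, by omega, by omega⟩
  rcases mul_pos_iff.1 hpq with h | h
  · exact key a b p q hab h.1 h.2
  · obtain ⟨β, γ, h1, h2, h3⟩ := key (-a) (-b) (-p) (-q) (by omega) (by omega) (by omega)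
    exact ⟨-β, -γ, by omega, by omega, by omega⟩

theorem oneNorm_add_single (u : ℕ →₀ ℤ) (i : ℕ) (c : ℤ) :
    oneNorm (u + Finsupp.single i c) + (u i).natAbs = oneNorm u + (u i + c).natAbs := by
  have hs1 : u.support ⊆ insert i u.support := subset_insert _ _
  have hs2 : (u + Finsupp.single i c).support ⊆ insert i u.support := fun k hk => by
    by_contra h
    rw [mem_insert, not_or, Finsupp.notMem_support_iff] at h
    rw [Finsupp.mem_support_iff] at hk
    simp [h.2, Ne.symm h.1] at hk
  rw [oneNorm, oneNorm, Finsupp.sum_of_support_subset _ hs1 _ (by simp),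
    Finsupp.sum_of_support_subset _ hs2 _ (by simp),
    ← add_sum_erase _ _ (mem_insert_self i u.support),
    ← add_sum_erase (insert i u.support) (fun k => (u k).natAbs) (mem_insert_self i u.support),
    sum_congr rfl (g := fun k => (u k).natAbs) fun k hk => by
      simp [(mem_erase.1 hk).1.symm]]
  simp
  ring

theorem oneNorm_equivMapDomain (σ : Equiv.Perm ℕ) (u : ℕ →₀ ℤ) :
    oneNorm (Finsupp.equivMapDomain σ u) = oneNorm u := by
  simp [oneNorm, Finsupp.sum_equivMapDomain]

theorem oneNorm_merge {u : ℕ →₀ ℤ} {i j : ℕ} (hij : i ≠ j) (h : 0 < u i * u j) :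
    oneNorm (u + Finsupp.single i (u j) + Finsupp.single j (-u j)) = oneNorm u := by
  have h1 := oneNorm_add_single u i (u j)
  have h2 := oneNorm_add_single (u + Finsupp.single i (u j)) j (-u j)
  have h3 : (u + Finsupp.single i (u j)) j = u j := by simp [hij]
  rw [h3] at h2
  rcases mul_pos_iff.1 h with h | h <;> omega

theorem le_oneNorm_of_forall_ne_zero {u : ℕ →₀ ℤ} {n : ℕ} (h : ∀ k < n, u k ≠ 0) :
    n ≤ oneNorm u := by
  have hs : range n ⊆ u.support := fun k hk => by simpa using h k (mem_range.1 hk)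
  have h1 := card_le_card hs
  rw [card_range] at h1
  refine h1.trans ?_
  rw [card_eq_sum_ones, oneNorm, Finsupp.sum]
  exact sum_le_sum fun k hk => by
    have := Finsupp.mem_support_iff.1 hk
    omega

theorem oneNorm_le_setNorm {A : Set (ℕ →₀ ℤ)} (hA : A.Finite) {u : ℕ →₀ ℤ} (hu : u ∈ A) :
    oneNorm u ≤ setNorm A :=
  le_csSup (hA.image _).bddAbove ⟨u, hu, rfl⟩

/-! ### Descent of irreducibles and the stability bound -/

theorem hull_symOrbit_hull (n : ℕ) (A : Set (ℕ →₀ ℝ)) :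
    PointedCone.hull ℝ (symOrbit n (PointedCone.hull ℝ A : Set (ℕ →₀ ℝ))) =
      PointedCone.hull ℝ (symOrbit n A) := by
  refine le_antisymm (Submodule.span_le.2 ?_) (Submodule.span_mono ?_)
  · rintro _ ⟨σ, hσ, u, hu, rfl⟩
    have hle : PointedCone.hull ℝ A ≤ (PointedCone.hull ℝ (symOrbit n A)).comap
        (Finsupp.domLCongr (R := ℝ) (M := ℝ) σ).toLinearMap :=
      Submodule.span_le.2 fun x hx => PointedCone.subset_hull ⟨σ, hσ, x, hx, rfl⟩
    exact hle hu
  · rintro _ ⟨σ, hσ, u, hu, rfl⟩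
    exact ⟨σ, hσ, u, PointedCone.subset_hull hu, rfl⟩

theorem exists_generators {C : ℕ → PointedCone ℝ (ℕ →₀ ℝ)} {r : ℕ} (hC : IsSymInvariantChain C)
    (hr : 1 ≤ r) (hfg : IsFinGenRational (C r)) (hst : ConesStabilizeAt C r) :
    ∃ A : Set (ℕ →₀ ℝ), A.Finite ∧ (∀ x ∈ A, ∀ i, r ≤ i → x i = 0) ∧
      ∀ n, r ≤ n → C n = PointedCone.hull ℝ (symOrbit n A) := by
  obtain ⟨A, hA, hCr⟩ := hfg
  refine ⟨intToReal '' A, hA.image _, fun x hx => ?_, fun n hn => ?_⟩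
  · exact hC.vanish r hr x (by rw [hCr]; exact PointedCone.subset_hull hx)
  · rw [hst r n le_rfl hn, hCr, hull_symOrbit_hull]

/-- The cones of a stabilizing chain are saturated from `n = 2 r` on. -/
theorem mem_of_mem_succ {C : ℕ → PointedCone ℝ (ℕ →₀ ℝ)} {r n : ℕ} (hC : IsSymInvariantChain C)
    (hr : 1 ≤ r) (hfg : IsFinGenRational (C r)) (hst : ConesStabilizeAt C r) (hn : 2 * r ≤ n)
    {u : ℕ →₀ ℝ} (hu : u ∈ C (n + 1)) (hun : u n = 0) : u ∈ C n := by
  obtain ⟨A, hA, hAr, hCA⟩ := exists_generators hC hr hfg hst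
  rw [hCA (n + 1) (by omega)] at hu
  rw [hCA n (by omega)]
  exact mem_hull_symOrbit_of_succ hr hn hA hAr hu hun

/-- Merge two coordinates of equal sign, move the resulting zero to the last place and apply
saturation. Equal signs preserve the norm and keep the merged entry nonzero. -/
theorem exists_mem_hilbertBasis_of_succ {C : ℕ → PointedCone ℝ (ℕ →₀ ℝ)} {r n : ℕ}
    (hC : IsSymInvariantChain C) (hr : 1 ≤ r) (hfg : IsFinGenRational (C r))
    (hst : ConesStabilizeAt C r) (hn : 2 * r ≤ n) (hn' : 4 * r ≤ n + 2) {h : ℕ →₀ ℤ}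
    (hh : h ∈ hilbertBasis (latticePoints (C (n + 1)))) (hfull : ∀ k < n + 1, h k ≠ 0) :
    ∃ g ∈ hilbertBasis (latticePoints (C n)), (∀ k < n, g k ≠ 0) ∧ oneNorm g = oneNorm h := by
  obtain ⟨A, hA, hAr, hCA⟩ := exists_generators hC hr hfg hst
  have hT := isSparseSymSet_symOrbit (n := n + 1) (by omega) hA hAr
  have hinv := hC.invariant (n + 1) (by omega)
  obtain ⟨hhM, hh0, hirr⟩ := hh
  have hhM' : intToReal h ∈ PointedCone.hull ℝ (symOrbit (n + 1) A) := by
    rw [← hCA (n + 1) (by omega)]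
    exact hhM
  obtain ⟨i, hi, j, hj, hij, hpos, hmem⟩ := exists_merge hT hr hhM'
    (fun k hk => by rw [intToReal_apply]; exact_mod_cast hfull k hk) (by omega)
  have hpos' : 0 < h i * h j := by
    rw [intToReal_apply, intToReal_apply] at hpos
    exact_mod_cast hpos
  set h' := h + Finsupp.single i (h j) + Finsupp.single j (-h j) with hh'
  have hh'M : intToReal h' ∈ C (n + 1) := by
    rw [hCA (n + 1) (by omega)]
    convert hmem using 1
    rw [hh', map_add, map_add, intToReal_single, intToReal_single, intToReal_apply]
    simp
    abel
  have hh'i : h' i = h i + h j := by simp [hh', hij.symm]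
  have hh'j : h' j = 0 := by simp [hh', hij]
  have hh'k : ∀ k, k ≠ i → k ≠ j → h' k = h k := fun k hki hkj => by
    simp [hh', hki.symm, hkj.symm]
  have hij0 : h i + h j ≠ 0 := by
    rcases mul_pos_iff.1 hpos' with h | h <;> omega
  have hswap := swap_mem_symGroup (n := n + 1) hj (Nat.lt_succ_self n)
  set g := Finsupp.equivMapDomain (Equiv.swap j n) h' with hg
  have hgM : intToReal g ∈ C n := by
    refine mem_of_mem_succ hC hr hfg hst hn ?_ ?_
    · rw [hg, intToReal_equivMapDomain]
      exact equivMapDomain_mem hinv hswap hh'M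
    · simp [intToReal_apply, hg, hh'j]
  have hh'ne : ∀ k < n + 1, k ≠ j → h' k ≠ 0 := by
    intro k hk hkj
    by_cases hki : k = i
    · rw [hki, hh'i]
      exact hij0
    · rw [hh'k k hki hkj]
      exact hfull k hk
  refine ⟨g, ⟨hgM, ?_, ?_⟩, ?_, ?_⟩
  · intro hg0
    have h1 : h' = 0 := by
      rw [← equivMapDomain_swap_swap j n h', ← hg, hg0]
      ext
      rfl
    exact hij0 (by rw [← hh'i, h1]; rfl)
  · intro v hv w hw hvw
    have hup : ∀ v ∈ latticePoints (C n), intToReal (Finsupp.equivMapDomain (Equiv.swap j n) v) ∈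
        C (n + 1) ∧ Finsupp.equivMapDomain (Equiv.swap j n) v j = 0 := fun v hv => by
      refine ⟨?_, ?_⟩
      · rw [intToReal_equivMapDomain]
        exact equivMapDomain_mem hinv hswap (hC.ascending n (n + 1) (by omega) (by omega) hv)
      · have := hC.vanish n (by omega) _ hv n le_rfl
        rw [intToReal_apply] at this
        simpa using this
    obtain ⟨hvM, hvj⟩ := hup v hv
    obtain ⟨hwM, hwj⟩ := hup w hw
    set v' := Finsupp.equivMapDomain (Equiv.swap j n) v with hv'
    set w' := Finsupp.equivMapDomain (Equiv.swap j n) w with hw'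
    have hsum : h' = v' + w' := by
      rw [← equivMapDomain_swap_swap j n h', ← hg, hvw, hv', hw',
        Finsupp.equivMapDomain_eq_mapDomain, Finsupp.mapDomain_add,
        ← Finsupp.equivMapDomain_eq_mapDomain, ← Finsupp.equivMapDomain_eq_mapDomain]
    have hab : v' i + w' i = h i + h j := by
      rw [← hh'i, hsum]
      rfl
    -- Spreading `β` and `γ` from `i` back to `j` turns the decomposition of `h'` into one of `h`; a
    -- summand that becomes zero was zero before.
    obtain ⟨β, γ, hβγ, hβ, hγ⟩ := exists_split hab hpos'
    have hspread : ∀ (v : ℕ →₀ ℤ) (β : ℤ), intToReal v ∈ C (n + 1) → v j = 0 →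
        (0 ≤ β ∧ β ≤ v i ∨ v i ≤ β ∧ β ≤ 0) →
        v - Finsupp.single i β + Finsupp.single j β ∈ latticePoints (C (n + 1)) := by
      intro v β hv hvj hβ
      rw [mem_latticePoints, map_add, map_sub, intToReal_single, intToReal_single]
      refine spread_mem hinv hv hi hj (by rw [intToReal_apply, hvj, Int.cast_zero]) ?_
      rw [intToReal_apply]
      exact_mod_cast hβ
    have hzero : ∀ (v : ℕ →₀ ℤ) (β : ℤ), v j = 0 →
        v - Finsupp.single i β + Finsupp.single j β = 0 →
        Finsupp.equivMapDomain (Equiv.swap j n) v = 0 := by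
      intro v β hvj hv
      have h1 := DFunLike.congr_fun hv j
      simp [hij, hvj] at h1
      have h2 : v = 0 := by simpa [h1] using hv
      rw [h2]
      ext
      rfl
    have hdec : h = (v' - Finsupp.single i β + Finsupp.single j β) +
        (w' - Finsupp.single i γ + Finsupp.single j γ) := by
      have : h = h' - Finsupp.single i (h j) + Finsupp.single j (h j) := by
        rw [hh', Finsupp.single_neg]
        abel
      rw [this, hsum, ← hβγ, Finsupp.single_add, Finsupp.single_add]
      abel
    rcases hirr _ (hspread v' β hvM hvj hβ) _ (hspread w' γ hwM hwj hγ) hdec with h | h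
    · left
      rw [← equivMapDomain_swap_swap j n v]
      exact hzero v' β hvj h
    · right
      rw [← equivMapDomain_swap_swap j n w]
      exact hzero w' γ hwj h
  · intro k hk
    rw [hg, Finsupp.equivMapDomain_apply, Equiv.symm_swap]
    by_cases hkj : k = j
    · rw [hkj, Equiv.swap_apply_left]
      exact hh'ne n (by omega) (by omega)
    · rw [Equiv.swap_apply_of_ne_of_ne hkj (by omega)]
      exact hh'ne k (by omega) hkj
  · rw [hg, oneNorm_equivMapDomain, hh', oneNorm_merge hij hpos']

theorem exists_mem_hilbertBasis_of_le {C : ℕ → PointedCone ℝ (ℕ →₀ ℝ)} {r m : ℕ}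
    (hC : IsSymInvariantChain C) (hr : 1 ≤ r) (hfg : IsFinGenRational (C r))
    (hst : ConesStabilizeAt C r) (hm : 4 * r ≤ m + 2) {n : ℕ} (hmn : m ≤ n) :
    ∀ h ∈ hilbertBasis (latticePoints (C n)), (∀ k < n, h k ≠ 0) →
      ∃ g ∈ hilbertBasis (latticePoints (C m)), oneNorm g = oneNorm h := by
  induction n, hmn using Nat.le_induction with
  | base => exact fun h hh _ => ⟨h, hh, rfl⟩
  | succ n hmn ih =>
    intro h hh hfull
    obtain ⟨g, hg, hgfull, hgh⟩ := exists_mem_hilbertBasis_of_succ hC hr hfg hst (by omega)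
      (by omega) hh hfull
    obtain ⟨g', hg', h'⟩ := ih g hg hgfull
    exact ⟨g', hg', h'.trans hgh⟩

theorem closure_symOrbit_le {C : ℕ → PointedCone ℝ (ℕ →₀ ℝ)} (hC : IsSymInvariantChain C)
    {m n : ℕ} (hm : 1 ≤ m) (hmn : m ≤ n) :
    AddSubmonoid.closure (symOrbit n (latticePoints (C m) : Set (ℕ →₀ ℤ))) ≤
      latticePoints (C n) := by
  refine AddSubmonoid.closure_le.2 ?_
  rintro _ ⟨σ, hσ, u, hu, rfl⟩
  rw [SetLike.mem_coe, mem_latticePoints, intToReal_equivMapDomain]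
  exact equivMapDomain_mem (hC.invariant n (hm.trans hmn)) hσ (hC.ascending m n hm hmn hu)

theorem equivMapDomain_mem_closure_symOrbit {n : ℕ} {A : Set (ℕ →₀ ℤ)} {σ : Equiv.Perm ℕ}
    (hσ : σ ∈ symGroup n) {u : ℕ →₀ ℤ} (hu : u ∈ AddSubmonoid.closure (symOrbit n A)) :
    Finsupp.equivMapDomain σ u ∈ AddSubmonoid.closure (symOrbit n A) := by
  have hle : AddSubmonoid.closure (symOrbit n A) ≤ (AddSubmonoid.closure (symOrbit n A)).comap
      (Finsupp.domCongr (M := ℤ) σ).toAddMonoidHom :=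
    AddSubmonoid.closure_le.2 fun x hx =>
      AddSubmonoid.subset_closure (equivMapDomain_mem_symOrbit hσ hx)
  exact hle hu

theorem symOrbit_mono {K : Type*} [Zero K] {m n : ℕ} (h : m ≤ n) (A : Set (ℕ →₀ K)) :
    symOrbit m A ⊆ symOrbit n A := by
  rintro _ ⟨σ, hσ, u, hu, rfl⟩
  exact ⟨σ, symGroup_mono h hσ, u, hu, rfl⟩

theorem monoidsStabilizeAt_of_le {C : ℕ → PointedCone ℝ (ℕ →₀ ℝ)} {r N m : ℕ}
    (hC : IsSymInvariantChain C) (hpt : ∀ n, 1 ≤ n → IsPointed (C n))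
    (hfg : ∀ n, 1 ≤ n → IsFinGenRational (C n)) (hr : 1 ≤ r) (hst : ConesStabilizeAt C r)
    (hm : 2 * r ≤ m) (hm' : 4 * r ≤ m + 2) (hmN : m ≤ N)
    (hN : setNorm (hilbertBasis (latticePoints (C m))) ≤ N) :
    MonoidsStabilizeAt (fun n => latticePoints (C n)) N := by
  intro k n hk hkn
  refine le_antisymm ?_ (closure_symOrbit_le hC (by omega) hkn)
  induction n, hkn using Nat.le_induction with
  | base => exact fun u hu => AddSubmonoid.subset_closure (subset_symOrbit _ _ hu)
  | succ n hkn ih =>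
    have hn1 : 1 ≤ n + 1 := by omega
    obtain ⟨f, hf⟩ := exists_grading hn1 (hC.invariant _ hn1) (hC.vanish _ hn1) (hpt _ hn1)
    simp only at ih ⊢
    rw [← closure_hilbertBasis hf]
    refine AddSubmonoid.closure_le.2 fun h hh => ?_
    -- With full support the norm is at least `n + 1 > N`, yet it is attained in the Hilbert basis
    -- at level `m`.
    have hzero : ∃ j < n + 1, h j = 0 := by
      by_contra! hfull
      obtain ⟨g, hg, hgh⟩ := exists_mem_hilbertBasis_of_le hC hr (hfg r hr) hst hm'
        (by omega) h hh hfull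
      have h1 := oneNorm_le_setNorm (finite_hilbertBasis (hfg m (by omega))) hg
      have h2 := le_oneNorm_of_forall_ne_zero hfull
      omega
    obtain ⟨j, hj, hj0⟩ := hzero
    have hswap := swap_mem_symGroup (n := n + 1) hj (Nat.lt_succ_self n)
    have hmem : Finsupp.equivMapDomain (Equiv.swap j n) h ∈ latticePoints (C n) := by
      refine mem_of_mem_succ hC hr (hfg r hr) hst (by omega) ?_ ?_
      · rw [intToReal_equivMapDomain]
        exact equivMapDomain_mem (hC.invariant _ hn1) hswap hh.1
      · simp [intToReal_apply, hj0]
    rw [← equivMapDomain_swap_swap j n h]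
    exact equivMapDomain_mem_closure_symOrbit hswap
      (AddSubmonoid.closure_mono (symOrbit_mono (Nat.le_succ n) _) (ih hmem))

theorem exists_monoidStabilityIndex_le {M : ℕ → AddSubmonoid (ℕ →₀ ℤ)} {N : ℕ} (hN : 1 ≤ N)
    (hM : MonoidsStabilizeAt M N) : ∃ s, IsMonoidStabilityIndex M s ∧ s ≤ N := by
  classical
  have hex : ∃ s, 1 ≤ s ∧ MonoidsStabilizeAt M s := ⟨N, hN, hM⟩
  exact ⟨Nat.find hex, ⟨Nat.find_spec hex, fun s hs => Nat.find_min' hex hs⟩,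
    Nat.find_min' hex ⟨hN, hM⟩⟩

theorem exists_monoidStabilityIndex {C : ℕ → PointedCone ℝ (ℕ →₀ ℝ)} {r : ℕ}
    (hC : IsSymInvariantChain C) (hpt : ∀ n, 1 ≤ n → IsPointed (C n))
    (hfg : ∀ n, 1 ≤ n → IsFinGenRational (C n)) (hr : IsConeStabilityIndex C r) :
    ∃ s : ℕ, IsMonoidStabilityIndex (fun n => latticePoints (C n)) s ∧
      s ≤ max (3 * r ^ 2) (setNorm (hilbertBasis (latticePoints (C (3 * r ^ 2))))) := by
  obtain ⟨hr1, hst⟩ := hr.1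
  refine exists_monoidStabilityIndex_le (le_max_of_le_left (by nlinarith)) ?_
  -- The argument needs only `2r ≤ m` and `4r ≤ m + 2`, both of which `3r²` satisfies.
  refine monoidsStabilizeAt_of_le hC hpt hfg hr1 hst (m := 3 * r ^ 2) ?_ ?_ (le_max_left _ _)
    (le_max_right _ _)
  · nlinarith
  · rcases hr1.eq_or_lt with rfl | h
    · norm_num
    · nlinarith

/-! ### The extremal example -/

theorem exists_mem_symGroup_apply {n i j : ℕ} (hn : 2 ≤ n) (hi : i < n) (hj : j < n)
    (hij : i ≠ j) : ∃ σ ∈ symGroup n, σ 0 = i ∧ σ 1 = j := by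
  have hq : Equiv.swap 0 i j ≠ 0 := fun h => hij (by
    have := congrArg (Equiv.swap 0 i) h
    simpa using this.symm)
  have h0 := swap_mem_symGroup (n := n) (k := 0) (l := i) (by omega) hi
  refine ⟨Equiv.swap 0 i * Equiv.swap 1 (Equiv.swap 0 i j), mul_mem h0
    (swap_mem_symGroup (by omega) (apply_lt_of_mem_symGroup h0 hj)), ?_, ?_⟩
  · rw [Equiv.Perm.mul_apply, Equiv.swap_apply_of_ne_of_ne (by omega) hq.symm,
      Equiv.swap_apply_left]
  · rw [Equiv.Perm.mul_apply, Equiv.swap_apply_left, Equiv.swap_apply_self]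

theorem equivMapDomain_single_add_single {K : Type*} [AddCommGroup K] (σ : Equiv.Perm ℕ)
    (c d : K) :
    Finsupp.equivMapDomain σ (Finsupp.single 0 c + Finsupp.single 1 d) =
      Finsupp.single (σ 0) c + Finsupp.single (σ 1) d := by
  rw [Finsupp.equivMapDomain_eq_mapDomain, Finsupp.mapDomain_add, Finsupp.mapDomain_single,
    Finsupp.mapDomain_single]

theorem exampleChain_of_lt {a n : ℕ} (hn : n < 2) : exampleChain a n = ⊥ := if_pos hn

theorem exampleChain_of_le {a n : ℕ} (hn : 2 ≤ n) : exampleChain a n =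
    PointedCone.hull ℝ (symOrbit n {Finsupp.single 0 (-1 : ℝ) + Finsupp.single 1 (a : ℝ)}) :=
  if_neg (by omega)

theorem single_add_single_mem_exampleChain {a n i j : ℕ} (hn : 2 ≤ n) (hi : i < n) (hj : j < n)
    (hij : i ≠ j) :
    Finsupp.single i (-1 : ℝ) + Finsupp.single j (a : ℝ) ∈ exampleChain a n := by
  rw [exampleChain_of_le hn]
  obtain ⟨σ, hσ, rfl, rfl⟩ := exists_mem_symGroup_apply hn hi hj hij
  exact PointedCone.subset_hull ⟨σ, hσ, _, rfl, (equivMapDomain_single_add_single σ _ _).symm⟩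

theorem pairing_nonneg_of_mem_exampleChain {a n : ℕ} {y : ℕ → ℝ} (hy : ∀ i j, y i ≤ a * y j)
    {u : ℕ →₀ ℝ} (hu : u ∈ exampleChain a n) : 0 ≤ pairing y u := by
  by_cases hn : n < 2
  · rw [exampleChain_of_lt hn, Submodule.mem_bot] at hu
    simp [hu]
  · rw [exampleChain_of_le (not_lt.1 hn)] at hu
    refine pairing_nonneg_of_mem_hull ?_ hu
    rintro _ ⟨σ, hσ, _, rfl, rfl⟩
    rw [equivMapDomain_single_add_single, map_add, pairing_single, pairing_single]
    linarith [hy (σ 0) (σ 1)]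

theorem symOrbit_symOrbit {K : Type*} [Zero K] {m n : ℕ} (h : m ≤ n) (A : Set (ℕ →₀ K)) :
    symOrbit n (symOrbit m A) = symOrbit n A := by
  refine Set.Subset.antisymm ?_ ?_
  · rintro _ ⟨σ, hσ, u, hu, rfl⟩
    exact equivMapDomain_mem_symOrbit hσ (symOrbit_mono h A hu)
  · rintro _ ⟨σ, hσ, u, hu, rfl⟩
    exact ⟨σ, hσ, u, subset_symOrbit m A hu, rfl⟩

theorem isSymInvariantChain_exampleChain (a : ℕ) : IsSymInvariantChain (exampleChain a) where
  ascending m n _ hmn := by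
    by_cases hm : m < 2
    · rw [exampleChain_of_lt hm]
      exact bot_le
    · rw [exampleChain_of_le (not_lt.1 hm), exampleChain_of_le (by omega)]
      exact Submodule.span_mono (symOrbit_mono hmn _)
  vanish n _ u hu i hi := by
    by_cases hn : n < 2
    · rw [exampleChain_of_lt hn, Submodule.mem_bot] at hu
      simp [hu]
    · rw [exampleChain_of_le (not_lt.1 hn)] at hu
      have hle : PointedCone.hull ℝ
          (symOrbit n {Finsupp.single 0 (-1 : ℝ) + Finsupp.single 1 (a : ℝ)}) ≤
          (PointedCone.ofSubmodule (LinearMap.ker (Finsupp.lapply (R := ℝ) (M := ℝ) i))) := by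
        refine Submodule.span_le.2 ?_
        rintro _ ⟨σ, hσ, _, rfl, rfl⟩
        have h0 := apply_lt_of_mem_symGroup hσ (i := 0) (by omega)
        have h1 := apply_lt_of_mem_symGroup hσ (i := 1) (by omega)
        rw [equivMapDomain_single_add_single]
        have h0' : σ 0 ≠ i := by omega
        have h1' : σ 1 ≠ i := by omega
        simp [h0', h1']
      simpa using hle hu
  invariant n _ := by
    by_cases hn : n < 2
    · rw [exampleChain_of_lt hn]
      rintro _ ⟨σ, hσ, u, hu, rfl⟩
      have hu0 : u = 0 := hu
      rw [hu0, Finsupp.equivMapDomain_zero]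
      exact zero_mem _
    · rw [exampleChain_of_le (not_lt.1 hn)]
      refine (PointedCone.subset_hull (R := ℝ)).trans ?_
      rw [hull_symOrbit_hull, symOrbit_symOrbit le_rfl]

theorem isPointed_exampleChain {a : ℕ} (ha : 2 ≤ a) (n : ℕ) : IsPointed (exampleChain a n) := by
  refine (Submodule.eq_bot_iff _).2 fun u hu => ?_
  have ha' : (2 : ℝ) ≤ a := by exact_mod_cast ha
  -- As `a ≥ 2`, every functional with values in `[1, 2]` is nonnegative on the cone, hence zero on
  -- its lineality space; these functionals separate points.
  have key : ∀ y : ℕ → ℝ, (∀ i, 1 ≤ y i ∧ y i ≤ 2) → pairing y u = 0 := by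
    intro y hy
    have hy' : ∀ i j, y i ≤ a * y j := fun i j => by nlinarith [hy i, hy j]
    have h1 := pairing_nonneg_of_mem_exampleChain hy' hu.1
    have h2 := pairing_nonneg_of_mem_exampleChain hy' hu.2
    rw [map_neg] at h2
    linarith
  ext i
  have h1 := key (fun _ => 1) (fun i => by norm_num)
  have h2 := key (Function.update (fun _ => 1) i 2) (fun k => by
    by_cases hk : k = i
    · simp [hk]
    · simp [Function.update_of_ne hk])
  rw [pairing_update, h1] at h2
  norm_num at h2
  exact h2

theorem isFinGenRational_exampleChain (a n : ℕ) : IsFinGenRational (exampleChain a n) := by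
  by_cases hn : n < 2
  · exact ⟨∅, Set.finite_empty, by simp [exampleChain_of_lt hn]⟩
  · refine ⟨symOrbit n {Finsupp.single 0 (-1) + Finsupp.single 1 (a : ℤ)},
      finite_symOrbit n (Set.finite_singleton _), ?_⟩
    rw [exampleChain_of_le (not_lt.1 hn)]
    have hw : intToReal (Finsupp.single 0 (-1) + Finsupp.single 1 (a : ℤ)) =
        Finsupp.single 0 (-1 : ℝ) + Finsupp.single 1 (a : ℝ) := by
      rw [map_add, intToReal_single, intToReal_single]
      simp
    congr 1
    refine Set.Subset.antisymm ?_ ?_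
    · rintro _ ⟨σ, hσ, _, rfl, rfl⟩
      exact ⟨_, ⟨σ, hσ, _, rfl, rfl⟩, by rw [intToReal_equivMapDomain, hw]⟩
    · rintro _ ⟨_, ⟨σ, hσ, _, rfl, rfl⟩, rfl⟩
      exact ⟨σ, hσ, _, rfl, by rw [intToReal_equivMapDomain, hw]⟩

theorem isConeStabilityIndex_exampleChain (a : ℕ) :
    IsConeStabilityIndex (exampleChain a) 2 := by
  refine ⟨⟨by norm_num, fun m n hm hmn => ?_⟩, fun s hs => ?_⟩
  · rw [exampleChain_of_le (hm.trans hmn), exampleChain_of_le hm, hull_symOrbit_hull,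
      symOrbit_symOrbit hmn]
  · by_contra! h
    have hs1 : s = 1 := by have := hs.1; omega
    subst hs1
    have h12 := hs.2 1 2 le_rfl one_le_two
    have hmem := single_add_single_mem_exampleChain (a := a) (n := 2) (i := 0) (j := 1) le_rfl
      (by norm_num) (by norm_num) (by norm_num)
    rw [h12, exampleChain_of_lt one_lt_two] at hmem
    have hle : PointedCone.hull ℝ (symOrbit 2 ((⊥ : PointedCone ℝ (ℕ →₀ ℝ)) : Set (ℕ →₀ ℝ))) ≤
        ⊥ := by
      refine Submodule.span_le.2 ?_
      rintro _ ⟨σ, hσ, u, hu, rfl⟩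
      have hu0 : u = 0 := hu
      rw [hu0, Finsupp.equivMapDomain_zero]
      exact zero_mem _
    have h0 := DFunLike.congr_fun ((Submodule.mem_bot _).1 (hle hmem)) 0
    simp at h0

theorem single_mem_exampleChain {a n i : ℕ} (ha : 2 ≤ a) (hn : 2 ≤ n) (hi : i < n) :
    Finsupp.single i (1 : ℝ) ∈ exampleChain a n := by
  obtain ⟨j, hj, hij⟩ : ∃ j < n, i ≠ j := by
    by_cases h : i = 0
    · exact ⟨1, by omega, by omega⟩
    · exact ⟨0, by omega, h⟩
  have ha' : (2 : ℝ) ≤ a := by exact_mod_cast ha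
  have h1 := add_mem (PointedCone.smul_mem _ (by linarith : (0 : ℝ) ≤ a)
    (single_add_single_mem_exampleChain (a := a) hn hj hi hij.symm))
    (single_add_single_mem_exampleChain (a := a) hn hi hj hij)
  have h2 : (a : ℝ) • (Finsupp.single j (-1 : ℝ) + Finsupp.single i (a : ℝ)) +
      (Finsupp.single i (-1 : ℝ) + Finsupp.single j (a : ℝ)) =
      ((a : ℝ) ^ 2 - 1) • Finsupp.single i (1 : ℝ) := by
    ext k
    simp only [Finsupp.coe_add, Finsupp.coe_smul, Pi.add_apply, Pi.smul_apply, smul_eq_mul,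
      Finsupp.single_apply]
    split_ifs <;> ring
  rw [h2, PointedCone.smul_mem_iff _ (by nlinarith)] at h1
  exact h1

theorem mem_latticePoints_exampleChain_of_nonneg {a n : ℕ} (ha : 2 ≤ a) (hn : 2 ≤ n)
    {u : ℕ →₀ ℤ} (hu : ∀ i, n ≤ i → u i = 0) (hu0 : ∀ i, 0 ≤ u i) :
    u ∈ latticePoints (exampleChain a n) := by
  have h : intToReal u = ∑ i ∈ range n, (u i : ℝ) • Finsupp.single i (1 : ℝ) := by
    ext k
    rw [intToReal_apply, Finsupp.finsetSum_apply]
    by_cases hk : k < n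
    · simp [Finsupp.single_apply, hk]
    · simp [Finsupp.single_apply, hk, hu k (not_lt.1 hk)]
  rw [mem_latticePoints, h]
  exact sum_mem fun i hi => PointedCone.smul_mem _ (by exact_mod_cast hu0 i)
    (single_mem_exampleChain ha hn (mem_range.1 hi))

/-- The vector is the combination of the generators `a e_k - e_i` with weights `b k / a`, which sum
to `1`. -/
theorem sub_single_mem_latticePoints_exampleChain {a n i : ℕ} (ha : 2 ≤ a) (hn : 2 ≤ n)
    (hi : i < n) {b : ℕ →₀ ℤ} (hb : ∀ k, n ≤ k → b k = 0) (hb0 : ∀ k, 0 ≤ b k) (hbi : b i = 0)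
    (hsum : ∑ k ∈ range n, b k = a) :
    b - Finsupp.single i 1 ∈ latticePoints (exampleChain a n) := by
  have ha' : (a : ℝ) ≠ 0 := by
    have : 0 < a := by omega
    exact_mod_cast this.ne'
  have h : intToReal (b - Finsupp.single i 1) = ∑ k ∈ range n, ((b k : ℝ) / a) •
      (Finsupp.single i (-1 : ℝ) + Finsupp.single k (a : ℝ)) := by
    have h1 : (∑ k ∈ range n, (b k : ℝ)) = a := by exact_mod_cast hsum
    have h2 : ∑ k ∈ range n, (b k : ℝ) / a * -1 = -1 := by
      rw [← sum_mul, ← sum_div, h1, div_self ha', one_mul]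
    simp only [smul_add, sum_add_distrib, Finsupp.smul_single, smul_eq_mul,
      div_mul_cancel₀ _ ha']
    rw [← Finsupp.single_finsetSum, h2]
    ext k
    simp only [intToReal_apply, Finsupp.coe_sub, Pi.sub_apply, Finsupp.coe_add, Pi.add_apply,
      Finsupp.finsetSum_apply, Finsupp.single_apply, sum_ite_eq', mem_range]
    by_cases hk : k < n
    · by_cases hik : i = k <;> simp [hk, hik]
      ring
    · have hik : i ≠ k := fun h => hk (h ▸ hi)
      simp [hk, hb k (not_lt.1 hk), hik]
  rw [mem_latticePoints, h]
  refine sum_mem fun k hk => ?_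
  by_cases hki : k = i
  · rw [hki, hbi]
    simp
  · exact PointedCone.smul_mem _ (div_nonneg (by exact_mod_cast hb0 k) (by positivity))
      (single_add_single_mem_exampleChain hn hi (mem_range.1 hk) (Ne.symm hki))

theorem sum_range_nonneg_of_mem_exampleChain {a n : ℕ} {y : ℕ → ℤ} (hy : ∀ i j, y i ≤ a * y j)
    {u : ℕ →₀ ℤ} (hn : 1 ≤ n) (hu : u ∈ latticePoints (exampleChain a n)) :
    0 ≤ ∑ k ∈ range n, u k * y k := by
  have h := pairing_nonneg_of_mem_exampleChain (y := fun k => (y k : ℝ))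
    (fun i j => by exact_mod_cast hy i j) hu
  rw [pairing_eq_sum_range _ ((isSymInvariantChain_exampleChain a).vanish n hn _ hu)] at h
  simp only [intToReal_apply] at h
  exact_mod_cast h

theorem vanish_of_mem_latticePoints_exampleChain {a n : ℕ} (hn : 1 ≤ n) {u : ℕ →₀ ℤ}
    (hu : u ∈ latticePoints (exampleChain a n)) : ∀ k, n ≤ k → u k = 0 := fun k hk => by
  have := (isSymInvariantChain_exampleChain a).vanish n hn _ hu k hk
  rw [intToReal_apply] at this
  exact_mod_cast this

theorem eq_zero_of_mem_exampleChain {a n : ℕ} (ha : 2 ≤ a) (hn : 1 ≤ n) {u : ℕ →₀ ℤ}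
    (hu : u ∈ latticePoints (exampleChain a n)) (h : ∑ k ∈ range n, u k ≤ 0) : u = 0 := by
  have h0 := sum_range_nonneg_of_mem_exampleChain (y := fun _ => 1) (fun _ _ => by omega) hn hu
  simp only [mul_one] at h0
  have h1 := eq_zero_of_pairing_one_eq_zero hn
    ((isSymInvariantChain_exampleChain a).invariant n hn)
    ((isSymInvariantChain_exampleChain a).vanish n hn) (isPointed_exampleChain ha n) hu (by
      rw [pairing_eq_sum_range _ ((isSymInvariantChain_exampleChain a).vanish n hn _ hu)]
      simp only [intToReal_apply, mul_one]
      exact_mod_cast le_antisymm h h0)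
  exact intToReal_injective (by rw [h1, map_zero])

/-- Lattice points with a negative entry and the least possible sum of entries are irreducible. -/
theorem mem_hilbertBasis_exampleChain {a n i : ℕ} (ha : 2 ≤ a) (hn : 2 ≤ n) {u : ℕ →₀ ℤ}
    (hu : u ∈ latticePoints (exampleChain a n)) (hi : i < n) (hui : u i < 0)
    (hsum : ∑ k ∈ range n, u k = a - 1) :
    u ∈ hilbertBasis (latticePoints (exampleChain a n)) := by
  -- Test with the functional equal to `a` at `i` and `1` elsewhere. A summand negative at `i` thus
  -- uses up the whole coordinate sum, and the other one is zero.
  have key : ∀ v ∈ latticePoints (exampleChain a n), v i < 0 →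
      (a : ℤ) - 1 ≤ ∑ k ∈ range n, v k := by
    intro v hv hvi
    have h := sum_range_nonneg_of_mem_exampleChain
      (y := fun k => if k = i then (a : ℤ) else 1) (fun k l => by
        show (if k = i then (a : ℤ) else 1) ≤ a * (if l = i then (a : ℤ) else 1)
        split_ifs <;> nlinarith) (by omega) hv
    have h2 : ∑ k ∈ range n, v k * (if k = i then (a : ℤ) else 1) =
        ∑ k ∈ range n, v k + v i * (a - 1) := by
      rw [← add_sum_erase _ _ (mem_range.2 hi), ← add_sum_erase (range n) v (mem_range.2 hi),
        sum_congr rfl (g := v) fun k hk => by simp [(mem_erase.1 hk).1]]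
      simp only [if_true]
      ring
    rw [h2] at h
    nlinarith
  refine ⟨hu, fun h => by simp [h] at hui, fun v hv w hw huvw => ?_⟩
  have hs : ∑ k ∈ range n, v k + ∑ k ∈ range n, w k = a - 1 := by
    rw [← sum_add_distrib, ← hsum, huvw]
    rfl
  have hi' : u i = v i + w i := by rw [huvw]; rfl
  by_cases hvi : v i < 0
  · right
    have := key v hv hvi
    exact eq_zero_of_mem_exampleChain ha (by omega) hw (by omega)
  · left
    have := key w hw (by omega)
    exact eq_zero_of_mem_exampleChain ha (by omega) hv (by omega)

theorem exists_le_sum_eq (n : ℕ) {f : ℕ →₀ ℤ} (hf0 : ∀ k, 0 ≤ f k) (a : ℕ)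
    (h : (a : ℤ) ≤ ∑ k ∈ range n, f k) :
    ∃ b : ℕ →₀ ℤ, (∀ k, 0 ≤ b k) ∧ (∀ k, b k ≤ f k) ∧ ∑ k ∈ range n, b k = a := by
  induction a with
  | zero => exact ⟨0, by simp, by simpa using hf0, by simp⟩
  | succ a ih =>
    push_cast at h
    obtain ⟨b, hb0, hbf, hb⟩ := ih (by omega)
    obtain ⟨k, hk, hbk⟩ : ∃ k ∈ range n, b k < f k := by
      refine exists_lt_of_sum_lt ?_
      omega
    refine ⟨b + Finsupp.single k 1, fun l => ?_, fun l => ?_, ?_⟩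
    · have := hb0 l
      simp only [Finsupp.coe_add, Pi.add_apply, Finsupp.single_apply]
      split_ifs <;> omega
    · have := hbf l
      simp only [Finsupp.coe_add, Pi.add_apply, Finsupp.single_apply]
      split_ifs with hkl
      · subst hkl; omega
      · omega
    · simp only [Finsupp.coe_add, Pi.add_apply, sum_add_distrib, hb, Finsupp.single_apply]
      simp [mem_range.1 hk]

/-- A generator with a single entry `-1` can be split off a vector with a negative entry. -/
theorem exists_peel {a n i : ℕ} (ha : 2 ≤ a) (hn : 2 ≤ n) {u : ℕ →₀ ℤ}
    (hu : ∀ k, n ≤ k → u k = 0) (hui : u i < 0)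
    (h : a * ∑ k ∈ range n, max (-u k) 0 ≤ ∑ k ∈ range n, max (u k) 0) :
    ∃ v ∈ latticePoints (exampleChain a n), v ≠ 0 ∧ (∀ k, n ≤ k → (u - v) k = 0) ∧
      ∑ k ∈ range n, max (-(u - v) k) 0 = ∑ k ∈ range n, max (-u k) 0 - 1 ∧
      ∑ k ∈ range n, max ((u - v) k) 0 = ∑ k ∈ range n, max (u k) 0 - a := by
  have hi : i < n := by
    by_contra hi
    have := hu i (not_lt.1 hi)
    omega
  have hN : 1 ≤ ∑ k ∈ range n, max (-u k) 0 := by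
    refine le_trans ?_ (single_le_sum (fun k _ => le_max_right _ _) (mem_range.2 hi))
    omega
  -- The positive part has sum at least `a`, since the negative part has sum at least `1`; `b` takes
  -- exactly `a` units of it.
  obtain ⟨b, hb0, hbf, hb⟩ := exists_le_sum_eq n
    (f := u.mapRange (fun c => max c 0) (by simp)) (fun k => by simp) a (by
      simp only [Finsupp.mapRange_apply]
      nlinarith)
  simp only [Finsupp.mapRange_apply] at hbf
  have hbn : ∀ k, n ≤ k → b k = 0 := fun k hk => by
    have h1 := hb0 k
    have h2 := hbf k
    have h3 := hu k hk
    omega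
  have hbi : b i = 0 := by
    have h1 := hb0 i
    have h2 := hbf i
    omega
  have happ : ∀ k, (u - (b - Finsupp.single i 1) : ℕ →₀ ℤ) k = u k - b k + if i = k then 1 else 0 := by
    intro k
    simp only [Finsupp.coe_sub, Pi.sub_apply, Finsupp.single_apply]
    ring
  refine ⟨b - Finsupp.single i 1,
    sub_single_mem_latticePoints_exampleChain ha hn hi hbn hb0 hbi hb, ?_, ?_, ?_, ?_⟩
  · intro h0
    have := DFunLike.congr_fun h0 i
    simp [hbi] at this
  · intro k hk
    rw [happ, hu k hk, hbn k hk, if_neg (by omega)]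
    rfl
  · have h1 : (∑ k ∈ range n, if i = k then 1 else 0) = (1 : ℤ) := by simp [hi]
    refine Eq.trans ?_ (congrArg (_ - ·) h1)
    rw [← sum_sub_distrib]
    refine sum_congr rfl fun k _ => ?_
    rw [happ]
    have h2 := hb0 k
    have h3 := hbf k
    split_ifs with hik
    · subst hik; omega
    · omega
  · rw [← hb, ← sum_sub_distrib]
    refine sum_congr rfl fun k _ => ?_
    rw [happ]
    have h2 := hb0 k
    have h3 := hbf k
    split_ifs with hik
    · subst hik; omega
    · omega

/-- Peeling lowers the negative part by `1` and the positive part by `a`, so the inequality survives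
until no negative entry is left. -/
theorem mem_latticePoints_exampleChain_of_le {a n : ℕ} (ha : 2 ≤ a) (hn : 2 ≤ n) {u : ℕ →₀ ℤ}
    (hu : ∀ k, n ≤ k → u k = 0)
    (h : a * ∑ k ∈ range n, max (-u k) 0 ≤ ∑ k ∈ range n, max (u k) 0) :
    u ∈ latticePoints (exampleChain a n) := by
  obtain ⟨N, hN⟩ : ∃ N : ℕ, ∑ k ∈ range n, max (-u k) 0 = N :=
    Int.eq_ofNat_of_zero_le (sum_nonneg fun k _ => le_max_right _ _)
  induction N generalizing u with
  | zero =>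
    refine mem_latticePoints_exampleChain_of_nonneg ha hn hu fun k => ?_
    by_cases hk : k < n
    · have := (sum_eq_zero_iff_of_nonneg (fun k _ => le_max_right _ _)).1 hN k (mem_range.2 hk)
      omega
    · exact (hu k (not_lt.1 hk)).ge
  | succ N ih =>
    obtain ⟨i, hi, hui⟩ : ∃ i ∈ range n, 0 < max (-u i) 0 := by
      refine exists_lt_of_sum_lt ?_
      rw [hN]
      simp
    obtain ⟨v, hv, -, hvan, h1, h2⟩ := exists_peel ha hn hu (i := i) (by omega) h
    have := ih hvan (by rw [h1, h2]; linarith) (by rw [h1, hN]; push_cast; ring)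
    rw [← add_sub_cancel v u]
    exact add_mem hv this

theorem oneNorm_eq_sum_range {n : ℕ} {u : ℕ →₀ ℤ} (hu : ∀ k, n ≤ k → u k = 0) :
    (oneNorm u : ℤ) = ∑ k ∈ range n, max (u k) 0 + ∑ k ∈ range n, max (-u k) 0 := by
  rw [oneNorm, Finsupp.sum_of_support_subset u (s := range n) _ _ (by simp), ← sum_add_distrib]
  · rw [Nat.cast_sum]
    refine sum_congr rfl fun k _ => ?_
    omega
  · intro k hk
    by_contra h
    exact Finsupp.mem_support_iff.1 hk (hu k (by simpa using h))

/-- An irreducible element with a negative entry equals the piece peeled off it, of norm `a + 1`;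
one without is a unit vector. -/
theorem oneNorm_le_of_mem_hilbertBasis_exampleChain {a n : ℕ} (ha : 2 ≤ a) (hn : 2 ≤ n)
    {u : ℕ →₀ ℤ} (hu : u ∈ hilbertBasis (latticePoints (exampleChain a n))) :
    oneNorm u ≤ a + 1 := by
  obtain ⟨huM, hu0, hirr⟩ := hu
  have hvan := vanish_of_mem_latticePoints_exampleChain (by omega) huM
  by_cases hneg : ∃ i, u i < 0
  · obtain ⟨i, hui⟩ := hneg
    -- The functional is `a` on the negative entries and `1` elsewhere, which yields the inequality
    -- that peeling needs.
    have h := sum_range_nonneg_of_mem_exampleChain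
      (y := fun k => if u k < 0 then (a : ℤ) else 1) (fun k l => by
        show (if u k < 0 then (a : ℤ) else 1) ≤ a * (if u l < 0 then (a : ℤ) else 1)
        split_ifs <;> nlinarith) (by omega) huM
    have h' : ∑ k ∈ range n, u k * (if u k < 0 then (a : ℤ) else 1) =
        ∑ k ∈ range n, max (u k) 0 - a * ∑ k ∈ range n, max (-u k) 0 := by
      rw [mul_sum, ← sum_sub_distrib]
      refine sum_congr rfl fun k _ => ?_
      split_ifs with hk
      · rw [max_eq_right hk.le, max_eq_left (by omega)]
        ring
      · rw [max_eq_left (by omega), max_eq_right (by omega)]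
        ring
    rw [h', sub_nonneg] at h
    obtain ⟨v, hv, hv0, hvan', h1, h2⟩ := exists_peel ha hn hvan hui h
    have hw := mem_latticePoints_exampleChain_of_le ha hn hvan' (by rw [h1, h2]; linarith)
    rcases hirr v hv _ hw (by abel) with h3 | h3
    · exact absurd h3 hv0
    · rw [h3] at h1 h2
      simp at h1 h2
      have := oneNorm_eq_sum_range hvan
      omega
  · push Not at hneg
    obtain ⟨k, hk⟩ := Finsupp.ne_iff.1 hu0
    have hk' := hneg k
    simp only [Finsupp.coe_zero, Pi.zero_apply] at hk
    have hkn : k < n := by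
      by_contra h
      exact hk (hvan k (not_lt.1 h))
    have h1 : Finsupp.single k 1 ∈ latticePoints (exampleChain a n) :=
      mem_latticePoints_exampleChain_of_nonneg ha hn
        (fun i hi => Finsupp.single_eq_of_ne (by omega))
        (fun i => by rw [Finsupp.single_apply]; split_ifs <;> simp)
    have h2 : u - Finsupp.single k 1 ∈ latticePoints (exampleChain a n) :=
      mem_latticePoints_exampleChain_of_nonneg ha hn
        (fun i hi => by
          rw [Finsupp.coe_sub, Pi.sub_apply, hvan i hi, Finsupp.single_eq_of_ne (by omega), sub_zero])
        (fun i => by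
          have := hneg i
          rw [Finsupp.coe_sub, Pi.sub_apply, Finsupp.single_apply]
          split_ifs with h
          · subst h; omega
          · omega)
    rcases hirr _ h1 _ h2 (by abel) with h | h
    · simp at h
    · rw [sub_eq_zero.1 h]
      simp [oneNorm]

theorem setNorm_hilbertBasis_exampleChain {a n : ℕ} (ha : 2 ≤ a) (hn : 2 ≤ n) :
    setNorm (hilbertBasis (latticePoints (exampleChain a n))) = a + 1 := by
  refine IsGreatest.csSup_eq ⟨⟨Finsupp.single 1 (a : ℤ) - Finsupp.single 0 1, ?_, ?_⟩, ?_⟩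
  · have h : ∑ k ∈ range n, Finsupp.single 1 (a : ℤ) k = a := by
      simp [Finsupp.single_apply, (by omega : 1 < n)]
    refine mem_hilbertBasis_exampleChain (i := 0) ha hn
      (sub_single_mem_latticePoints_exampleChain ha hn (by omega)
        (fun k hk => Finsupp.single_eq_of_ne (by omega))
        (fun k => by rw [Finsupp.single_apply]; split_ifs <;> simp) (by simp) h)
      (by omega) (by simp) ?_
    simp only [Finsupp.coe_sub, Pi.sub_apply, sum_sub_distrib, h]
    simp [Finsupp.single_apply, (by omega : 0 < n)]
  · have h1 := oneNorm_add_single (Finsupp.single 1 (a : ℤ)) 0 (-1)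
    rw [Finsupp.single_neg, ← sub_eq_add_neg] at h1
    have h2 : oneNorm (Finsupp.single 1 (a : ℤ)) = a := by simp [oneNorm]
    simp [h2] at h1
    exact h1
  · rintro _ ⟨u, hu, rfl⟩
    exact oneNorm_le_of_mem_hilbertBasis_exampleChain ha hn hu

/-- The witness `(-1, 1, ..., 1)` with `a` ones is irreducible, so it belongs to every generating
set. It has no zero among its `a + 1` coordinates, unlike all vectors in the orbit of level `a`. -/
theorem lt_of_monoidsStabilizeAt_exampleChain {a s : ℕ} (ha : 2 ≤ a)
    (hs : MonoidsStabilizeAt (fun n => latticePoints (exampleChain a n)) s) : a < s := by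
  by_contra! hsa
  have h := hs a (a + 1) hsa (Nat.le_succ a)
  set b : ℕ →₀ ℤ := Finsupp.onFinset (range (a + 1))
    (fun k => if k ∈ range (a + 1) ∧ k ≠ 0 then 1 else 0) (fun k hk => by
      by_contra hk'
      simp [hk'] at hk) with hb
  have hbk : ∀ k, b k = if k ∈ range (a + 1) ∧ k ≠ 0 then 1 else 0 := fun k => rfl
  have hbsum : ∑ k ∈ range (a + 1), b k = a := by
    rw [sum_range_succ', sum_congr rfl (g := fun _ => (1 : ℤ)) fun k hk => by
      have := mem_range.1 hk
      rw [hbk, if_pos]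
      exact ⟨mem_range.2 (by omega), by omega⟩]
    simp [hbk]
  have hmem : b - Finsupp.single 0 1 ∈
      hilbertBasis (latticePoints (exampleChain a (a + 1))) := by
    refine mem_hilbertBasis_exampleChain (i := 0) ha (by omega)
      (sub_single_mem_latticePoints_exampleChain ha (by omega) (by omega)
        (fun k hk => by rw [hbk, if_neg]; simp; omega)
        (fun k => by rw [hbk]; split_ifs <;> simp) (by simp [hbk]) hbsum)
      (by omega) (by simp [hbk]) ?_
    simp only [Finsupp.coe_sub, Pi.sub_apply, sum_sub_distrib, hbsum]
    simp [Finsupp.single_apply]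
  obtain ⟨σ, hσ, v, hv, huv⟩ := hilbertBasis_subset_of_closure_eq h.symm hmem
  have hσa := apply_lt_of_mem_symGroup hσ (Nat.lt_succ_self a)
  have h1 : (b - Finsupp.single 0 1 : ℕ →₀ ℤ) (σ a) = 0 := by
    rw [huv, Finsupp.equivMapDomain_apply, Equiv.symm_apply_apply]
    exact vanish_of_mem_latticePoints_exampleChain (by omega) hv a le_rfl
  rw [Finsupp.coe_sub, Pi.sub_apply, hbk, Finsupp.single_apply] at h1
  by_cases h0 : σ a = 0
  · simp [h0] at h1
  · rw [if_pos ⟨mem_range.2 hσa, h0⟩, if_neg (Ne.symm h0)] at h1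
    norm_num at h1
theorem mainTheorem12 :
    -- the bound, for every chain
    (∀ (C : ℕ → PointedCone ℝ (ℕ →₀ ℝ)) (r : ℕ),
      IsSymInvariantChain C →
      (∀ n, 1 ≤ n → IsPointed (C n)) →
      (∀ n, 1 ≤ n → IsFinGenRational (C n)) →
      IsConeStabilityIndex C r →
      -- the Hilbert basis of `M_n` is finite, and is the least generating set of `M_n`
      (∀ n, 1 ≤ n →
        (hilbertBasis (latticePoints (C n))).Finite ∧
        IsLeast {A : Set (ℕ →₀ ℤ) | AddSubmonoid.closure A = latticePoints (C n)}
          (hilbertBasis (latticePoints (C n)))) ∧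
      ∃ s : ℕ, IsMonoidStabilityIndex (fun n => latticePoints (C n)) s ∧
        s ≤ max (3 * r ^ 2) (setNorm (hilbertBasis (latticePoints (C (3 * r ^ 2)))))) ∧
    -- the bound is attained
    (∀ a : ℕ, 11 ≤ a →
      IsSymInvariantChain (exampleChain a) ∧
      (∀ n, 1 ≤ n → IsPointed (exampleChain a n)) ∧
      (∀ n, 1 ≤ n → IsFinGenRational (exampleChain a n)) ∧
      IsConeStabilityIndex (exampleChain a) 2 ∧
      IsMonoidStabilityIndex (fun n => latticePoints (exampleChain a n)) (a + 1) ∧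
      max (3 * 2 ^ 2)
        (setNorm (hilbertBasis (latticePoints (exampleChain a (3 * 2 ^ 2))))) = a + 1) := by
  refine ⟨fun C r hC hpt hfg hr => ⟨fun n hn => ⟨finite_hilbertBasis (hfg n hn), ?_, ?_⟩,
    exists_monoidStabilityIndex hC hpt hfg hr⟩, fun a ha => ?_⟩
  · obtain ⟨f, hf⟩ := exists_grading hn (hC.invariant n hn) (hC.vanish n hn) (hpt n hn)
    exact closure_hilbertBasis hf
  · exact fun A hA => hilbertBasis_subset_of_closure_eq hA
  · have hC := isSymInvariantChain_exampleChain a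
    have hpt : ∀ n, 1 ≤ n → IsPointed (exampleChain a n) := fun n _ =>
      isPointed_exampleChain (by omega) n
    have hfg : ∀ n, 1 ≤ n → IsFinGenRational (exampleChain a n) := fun n _ =>
      isFinGenRational_exampleChain a n
    have hr := isConeStabilityIndex_exampleChain a
    have hmax : max (3 * 2 ^ 2)
        (setNorm (hilbertBasis (latticePoints (exampleChain a (3 * 2 ^ 2))))) = a + 1 := by
      rw [setNorm_hilbertBasis_exampleChain (by omega) (by norm_num)]
      -- This is where `a ≥ 11` is needed: `12 ≤ a + 1`.
      exact max_eq_right (by omega)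
    obtain ⟨s, hs, hsle⟩ := exists_monoidStabilityIndex hC hpt hfg hr
    have hlt := lt_of_monoidsStabilizeAt_exampleChain (by omega) hs.1.2
    obtain rfl : s = a + 1 := by omega
    exact ⟨hC, hpt, hfg, hr, hs, hmax⟩
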